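/- Let $0<\beta<1$. Write $E_\beta(z)=\sum_{n\ge 0} z^n/\Gamma(\beta n+1)$ for the Mittag-Leffler function ($E_\beta'$ is its derivative), $M_\beta(x)=\sum_{n\ge 0}\frac{(-x)^n}{n!\,\Gamma(-\beta n+1-\beta)}$ for the $M$-Wright function (with $1/\Gamma=0$ at the poles of $\Gamma$), ${}_tJ^{\mu}f(t)=\frac1{\Gamma(\mu)}\int_0^t(t-x)^{\mu-1}f(x)\,dx$ for the Riemann–Liouville integral, and $$L_\beta^{-\beta}(x)=\frac1{2\pi}\int_{-\infty}^{\infty}e^{-i\kappa x}\exp\!\big(-|\kappa|^\beta e^{-i\,\mathrm{sign}(\kappa)\,\beta\pi/2}\big)\,d\kappa$$ for the extremal stable density, i.e. the one with characteristic function $\exp(-|\kappa|^\beta e^{-i\,\mathrm{sign}(\kappa)\beta\pi/2})$. For $t,t_*>0$ put $$r_\beta(t,t_*)=t_*^{-1/\beta}L_\beta^{-\beta}\big(t/t_*^{1/\beta}\big),\qquad q_\beta(t_*,t)=t^{-\beta}M_\beta(t_*/t^\beta),$$ where the formula for $r_\beta$ is also used for $t\le 0$. Let $t=t(t_*)$,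 $t_*\ge 0$, be a $\beta$-stable subordinator on a probability space: $t(0)=0$ a.s., independent stationary increments, a.s. nondecreasing right-continuous paths, and $t(t_*)$ has density $r_\beta(\cdot,t_*)$ for each $t_*>0$. Let $t_*(t)=\inf\{t_*\ge 0: t(t_*)\ge t\}$ be its inverse process. Complex powers are principal values, and all Laplace integrals below converge absolutely. Then: 1. Almost surely, for all $T\ge0$ and $T_*\ge 0$: $t_*(T)\le T_*\iff T\le t(T_*)$; and $T\mapsto t_*(T)$ is nondecreasing on $[0,\infty)$. 2. For every $t>0$ the random variable $t_*(t)$ has density $q_\beta(\cdot,t)$ on $(0,\infty)$ (and $0$ on $(-\infty,0]$); $q_\beta(t_*,t)\ge0$ for $t_*>0$ and $\int_0^\infty q_\beta(t_*,t)\,dt_*=1$. 3. For $t,t_*>0$: $\int_0^{t_*}q_\beta(t_*',t)\,dt_*'=\int_t^\infty r_\beta(t',t_*)\,dt'$. 4. For $t,t_*>0$: $q_\beta(t_*,t)={}_tJ^{1-\beta}r_\beta(t,t_*)$, the integral being absolutely convergent. 5. For $t_*>0$ and $\mathrm{Re}\,s>0$: $\int_0^\infty e^{-st}r_\beta(t,t_*)\,dt=e^{-t_*s^\beta}$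 and $\int_0^\infty e^{-st}q_\beta(t_*,t)\,dt=s^{\beta-1}e^{-t_*s^\beta}$. 6. For $t>0$ and $\mathrm{Re}\,s_*\ge0$: $\int_0^\infty e^{-s_*t_*}r_\beta(t,t_*)\,dt_*=\beta t^{\beta-1}E_\beta'(-s_*t^\beta)$ and $\int_0^\infty e^{-s_*t_*}q_\beta(t_*,t)\,dt_*=E_\beta(-s_*t^\beta)$. 7. For $t>0$ and $\mathrm{Re}\,s_*>0$: $\int_t^\infty s_*\,\beta\,t'^{\,\beta-1}E_\beta'(-s_*t'^{\,\beta})\,dt'=E_\beta(-s_*t^\beta)$, the integral being absolutely convergent. 8. For $\mathrm{Re}\,s_*\ge0$ and $\mathrm{Re}\,s>0$, the double Laplace transforms (in $t_*$ at $s_*$ and in $t$ at $s$) of $r_\beta$ and $q_\beta$ are $$\frac{1}{s_*+s^\beta}\qquad\text{and}\qquad\frac{s^{\beta-1}}{s_*+s^\beta}.$$ -/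

import Mathlib

open MeasureTheory ProbabilityTheory Set
open scoped NNReal ENNReal

noncomputable section

/-- The Mittag-Leffler function `E_α(z) = ∑ zⁿ / Γ(α n + 1)`. -/
def mittagLeffler (α : ℝ) (z : ℂ) : ℂ :=
  ∑' n : ℕ, z ^ n / Complex.Gamma ((α * n + 1 : ℝ) : ℂ)

/-- The Wright function `W_{l,m}(x) = ∑ xⁿ / (n! Γ(l n + m))` on the real line. Since
`Real.Gamma` takes the value `0` at its poles, `1 / Γ` vanishes there, as usual. -/
def wrightFunction (l m x : ℝ) : ℝ :=
  ∑' n : ℕ, x ^ n / ((n.factorial : ℝ) * Real.Gamma (l * n + m))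

/-- The `M`-Wright function `M_ν(x) = W_{-ν, 1-ν}(-x)`. -/
def mWright (ν x : ℝ) : ℝ := wrightFunction (-ν) (1 - ν) (-x)

/-- The exponent `ψ(κ) = |κ|^α e^{i (sign κ) θ π / 2}` of the stable law with index `α` and
asymmetry `θ` (Feller's parametrization); the characteristic function
`∫ e^{iκx} L(x) dx` is `e^{-ψ(κ)}`. -/
def stableExponent (α θ κ : ℝ) : ℂ :=
  ((|κ| ^ α : ℝ) : ℂ) *
    Complex.exp (Complex.I * ((Real.sign κ * θ * Real.pi / 2 : ℝ) : ℂ))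

/-- The stable density `L_α^θ`: the inverse Fourier transform
`(1 / 2π) ∫ e^{-iκx} e^{-ψ(κ)} dκ` of the stable characteristic function. The integral is real
because `ψ(-κ)` is the conjugate of `ψ(κ)`. -/
def stableDensity (α θ x : ℝ) : ℝ :=
  1 / (2 * Real.pi) *
    (∫ κ : ℝ, Complex.exp (-(Complex.I * κ * x)) * Complex.exp (-stableExponent α θ κ)).re

/-- `r_β(t, τ) = τ^{-1/β} L_β^{-β}(t / τ^{1/β})`, a density in `t` for every `τ > 0`. -/
def rDensity (β t τ : ℝ) : ℝ :=
  τ ^ (-1 / β) * stableDensity β (-β) (t / τ ^ (1 / β))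

/-- `q_β(τ, t) = t^{-β} M_β(τ / t^β)`, a density in `τ` for every `t > 0`. -/
def qDensity (β τ t : ℝ) : ℝ :=
  t ^ (-β) * mWright β (τ / t ^ β)

/-- The Riemann-Liouville fractional integral of order `m`, based at `0`. -/
def riemannLiouville (m : ℝ) (f : ℝ → ℝ) (t : ℝ) : ℝ :=
  1 / Real.Gamma m * ∫ x in (0 : ℝ)..t, (t - x) ^ (m - 1) * f x

/-- The Laplace integral of `f` at `s` converges absolutely, with value `F`. -/
def HasLaplaceAt (f : ℝ → ℂ) (s F : ℂ) : Prop :=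
  IntegrableOn (fun x : ℝ => Complex.exp (-(s * x)) * f x) (Ioi 0) ∧
    ∫ x in Ioi (0 : ℝ), Complex.exp (-(s * x)) * f x = F

/-- The double Laplace integral of `f` at `(p, s)` converges absolutely, with value `F`
(by Fubini's theorem it then is the iterated transform in either order). -/
def HasDoubleLaplaceAt (f : ℝ → ℝ → ℂ) (p s F : ℂ) : Prop :=
  IntegrableOn (fun x : ℝ × ℝ =>
      Complex.exp (-(p * x.1)) * Complex.exp (-(s * x.2)) * f x.1 x.2) (Ioi 0 ×ˢ Ioi 0) ∧
    ∫ x in (Ioi (0 : ℝ)) ×ˢ (Ioi (0 : ℝ)),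
      Complex.exp (-(p * x.1)) * Complex.exp (-(s * x.2)) * f x.1 x.2 = F

/-- `T` is a `β`-stable subordinator under `P`: it starts at `0`, has independent stationary
increments and nondecreasing right-continuous paths, and `T τ` has density `r_β(·, τ)`
for every `τ > 0`. -/
structure IsStableSubordinator {Ω : Type*} [MeasurableSpace Ω] (β : ℝ) (T : ℝ≥0 → Ω → ℝ)
    (P : Measure Ω) : Prop where
  measurable : ∀ τ, Measurable (T τ)
  zero : ∀ᵐ ω ∂P, T 0 ω = 0
  indep : HasIndepIncrements T P
  stationary : ∀ σ h : ℝ≥0, IdentDistrib (fun ω => T (σ + h) ω - T σ ω) (T h) P P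
  mono : ∀ᵐ ω ∂P, Monotone fun τ => T τ ω
  rightCont : ∀ᵐ ω ∂P, ∀ τ, ContinuousWithinAt (fun σ => T σ ω) (Ici τ) τ
  density : ∀ τ : ℝ≥0, 0 < τ →
    P.map (T τ) = volume.withDensity fun t : ℝ => ENNReal.ofReal (rDensity β t τ)

/-- The inverse process: `t ↦ inf {τ ≥ 0 : T τ ≥ t}`. -/
def inverseProcess {Ω : Type*} (T : ℝ≥0 → Ω → ℝ) (t : ℝ) (ω : Ω) : ℝ≥0 :=
  sInf {τ : ℝ≥0 | t ≤ T τ ω}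

end

/-! Everything reduces to the extremal density `L = stableDensity β (-β)`. Its Fourier integral is
`1/π` times the imaginary part of `∫ exp (x s - s ^ β) ds` over the ray `s = i u`, and that ray may
be rotated. For `x ≤ 0` it turns to the positive axis, where the integrand is real, so `L` vanishes
(`stableDensity_of_nonpos`). For `x > 0` it turns to the negative axis; expanding the exponential of
the power there and using the reflection formula gives `L x = β x ^ (-β - 1) M (x ^ (-β))`
(`stableDensity_eq_mWright`). Thus `M` is the density of `X ^ (-β)` when `X` has density `L`, and `q
= t / (β τ) r` pointwise.

The same formula shows that `L` decays like `x ^ (-β - 1)`, so it is integrable and Fourier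
inversion recovers its characteristic function. Phragmén–Lindelöf carries this from the imaginary
axis to the right half-plane: the Laplace transform of `L` is `exp (-s ^ β)`
(`laplace_stableDensity`). Scaling gives the transform of `r` in `t`, and differentiating in `s`
gives that of `q`. The factor `s ^ (β - 1)` between the two is the transform of the fractional
kernel, so uniqueness of Laplace transforms identifies `q` with the fractional integral of `r`.

In `τ`, integrating `s ^ (a - 1) exp (-s ^ β)` yields the negative moments of `L`, hence the moments
`n! / Γ(β n + 1)` of `M` (`mWright_moment`). Summing the exponential series against them gives the
Mittag-Leffler function. These interchanges use `L ≥ 0`, which comes from the probability space: the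
law of `T 1` has density the positive part of `L`, of mass `1`, and `L` itself also integrates to
`1`.

For the process, right-continuity gives a Galois connection between a path and its inverse
(`sInf_le_iff_of_rightCont`). So the distribution function of the inverse at `τ` is the tail of `r`
at `t`, and the substitution `y = x ^ (-β)` turns this tail into the distribution function of `q`
(`integral_qDensity_eq_tail`). -/

/-! ### Rotation of the Bromwich ray -/

/-- The integrand of the Bromwich integral of `exp (-s ^ β)` along the ray of angle `θ`. -/
noncomputable def rayIntegrand (β x θ u : ℝ) : ℂ :=
  Complex.exp (Complex.I * θ) *
    Complex.exp (x * u * Complex.exp (Complex.I * θ) -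
      ((u ^ β : ℝ) : ℂ) * Complex.exp (Complex.I * (β * θ)))

/-- The logarithmic factor in the derivatives of `rayIntegrand`. -/
noncomputable def rayFactor (β x θ u : ℝ) : ℂ :=
  1 + x * u * Complex.exp (Complex.I * θ) -
    β * ((u ^ β : ℝ) : ℂ) * Complex.exp (Complex.I * (β * θ))

lemma norm_rayIntegrand (β x θ u : ℝ) :
    ‖rayIntegrand β x θ u‖ = Real.exp (x * u * Real.cos θ - u ^ β * Real.cos (β * θ)) := by
  have h1 : (Complex.I * (θ : ℂ)) = (θ : ℂ) * Complex.I := mul_comm _ _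
  have h2 : (Complex.I * ((β : ℂ) * θ)) = ((β * θ : ℝ) : ℂ) * Complex.I := by push_cast; ring
  rw [rayIntegrand, norm_mul, h1, h2, Complex.norm_exp_ofReal_mul_I, Complex.norm_exp, one_mul]
  congr 1
  rw [Complex.exp_ofReal_mul_I, Complex.exp_ofReal_mul_I]
  simp only [Complex.sub_re, Complex.mul_re, Complex.mul_im, Complex.add_re, Complex.add_im, Complex.ofReal_re, Complex.ofReal_im,
    Complex.I_re, Complex.I_im]
  ring

lemma norm_rayFactor_le {β : ℝ} (hβ : 0 < β) (x θ : ℝ) {u : ℝ} (hu : 0 < u) :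
    ‖rayFactor β x θ u‖ ≤ 1 + |x| * u + β * u ^ β := by
  have h1 : (Complex.I * (θ : ℂ)) = (θ : ℂ) * Complex.I := mul_comm _ _
  have h2 : (Complex.I * ((β : ℂ) * θ)) = ((β * θ : ℝ) : ℂ) * Complex.I := by push_cast; ring
  rw [rayFactor, h1, h2]
  refine (norm_sub_le _ _).trans ((add_le_add_left (norm_add_le _ _) _).trans (le_of_eq ?_))
  have hp : 0 < u ^ β := Real.rpow_pos_of_pos hu _
  simp only [norm_mul, Complex.norm_exp_ofReal_mul_I, Complex.norm_real, norm_one, mul_one,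
    Real.norm_eq_abs, abs_of_pos hu, abs_of_pos hβ, abs_of_pos hp]

lemma hasDerivAt_rayIntegrand_angle (β x θ u : ℝ) :
    HasDerivAt (fun θ => rayIntegrand β x θ u)
      (Complex.I * (rayFactor β x θ u * rayIntegrand β x θ u)) θ := by
  have h0 : HasDerivAt (fun θ : ℝ => Complex.I * (θ : ℂ)) Complex.I θ := by
    simpa using (Complex.ofRealCLM.hasDerivAt (x := θ)).const_mul Complex.I
  have h1 := h0.cexp
  have h0' : HasDerivAt (fun θ : ℝ => Complex.I * (β * (θ : ℂ))) (Complex.I * β) θ := by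
    simpa using ((Complex.ofRealCLM.hasDerivAt (x := θ)).const_mul (β : ℂ)).const_mul Complex.I
  have h2 := h0'.cexp
  have h3 := ((h1.const_mul ((x : ℂ) * u)).sub (h2.const_mul ((u ^ β : ℝ) : ℂ))).cexp
  refine (h1.mul h3).congr_deriv ?_
  simp only [rayIntegrand, rayFactor, Pi.sub_apply]
  ring

/-- Up to the factor `i` this is the angular derivative of the integrand: the Cauchy–Riemann
equation in polar form, which replaces a contour argument. -/
lemma hasDerivAt_rayIntegrand_radius (β x θ : ℝ) {u : ℝ} (hu : 0 < u) :
    HasDerivAt (fun u : ℝ => (u : ℂ) * rayIntegrand β x θ u)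
      (rayFactor β x θ u * rayIntegrand β x θ u) u := by
  have h0 : HasDerivAt (fun u : ℝ => (u : ℂ)) 1 u := (hasDerivAt_id u).ofReal_comp
  have h1 : HasDerivAt (fun u : ℝ => ((u ^ β : ℝ) : ℂ)) ((β * u ^ (β - 1) : ℝ) : ℂ) u :=
    (Real.hasDerivAt_rpow_const (Or.inl hu.ne')).ofReal_comp
  have h2 := (((h0.const_mul (x : ℂ)).mul_const (Complex.exp (Complex.I * θ))).sub
    (h1.mul_const (Complex.exp (Complex.I * (β * θ))))).cexp
  refine (h0.mul (h2.const_mul (Complex.exp (Complex.I * θ)))).congr_deriv ?_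
  have h3 : ((u ^ β : ℝ) : ℂ) = u * ((u ^ (β - 1) : ℝ) : ℂ) := by
    rw [← Complex.ofReal_mul, Real.rpow_sub_one hu.ne']
    congr 1
    field_simp
  simp only [rayIntegrand, rayFactor, Pi.sub_apply]
  rw [h3]
  push_cast
  ring

lemma continuous_rayIntegrand {β : ℝ} (hβ : 0 < β) (x : ℝ) :
    Continuous fun z : ℝ × ℝ => rayIntegrand β x z.1 z.2 := by
  have : Continuous fun z : ℝ × ℝ => z.2 ^ β :=
    (Real.continuous_rpow_const hβ.le).comp continuous_snd
  unfold rayIntegrand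
  fun_prop

lemma continuous_rayFactor {β : ℝ} (hβ : 0 < β) (x : ℝ) :
    Continuous fun z : ℝ × ℝ => rayFactor β x z.1 z.2 := by
  have : Continuous fun z : ℝ × ℝ => z.2 ^ β :=
    (Real.continuous_rpow_const hβ.le).comp continuous_snd
  unfold rayFactor
  fun_prop

lemma integrableOn_exp_neg_mul_rpow {β ε : ℝ} (hβ : 0 < β) (hε : 0 < ε) :
    IntegrableOn (fun u : ℝ => Real.exp (-ε * u ^ β)) (Ioi 0) := by
  simpa using integrableOn_rpow_mul_exp_neg_mul_rpow (s := 0) (by norm_num) hβ hε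

section Rotation

variable {β x C ε θ₁ θ₂ : ℝ}

lemma norm_rayIntegrand_le {θ u : ℝ} (h : x * u * Real.cos θ - u ^ β * Real.cos (β * θ) ≤ C - ε * u ^ β) :
    ‖rayIntegrand β x θ u‖ ≤ Real.exp C * Real.exp (-ε * u ^ β) := by
  rw [norm_rayIntegrand, ← Real.exp_add]
  exact Real.exp_le_exp.2 (h.trans (le_of_eq (by ring)))

lemma integrableOn_rayIntegrand (hβ : 0 < β) (hε : 0 < ε) {θ : ℝ}
    (h : ∀ u, 0 < u → x * u * Real.cos θ - u ^ β * Real.cos (β * θ) ≤ C - ε * u ^ β) :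
    IntegrableOn (fun u => rayIntegrand β x θ u) (Ioi 0) := by
  refine Integrable.mono' ((integrableOn_exp_neg_mul_rpow hβ hε).const_mul (Real.exp C)) ?_ ?_
  · exact ((continuous_rayIntegrand hβ x).comp (by fun_prop : Continuous fun u : ℝ => (θ, u))).aestronglyMeasurable
  · exact (ae_restrict_iff' measurableSet_Ioi).2 (.of_forall fun u hu => norm_rayIntegrand_le (h u hu))

lemma norm_rayFactor_mul_le (hβ : 0 < β) {θ u : ℝ} (hu : 0 < u)
    (h : x * u * Real.cos θ - u ^ β * Real.cos (β * θ) ≤ C - ε * u ^ β) :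
    ‖rayFactor β x θ u * rayIntegrand β x θ u‖ ≤
      (1 + |x| * u + β * u ^ β) * (Real.exp C * Real.exp (-ε * u ^ β)) := by
  rw [norm_mul]
  exact mul_le_mul (norm_rayFactor_le hβ x θ hu) (norm_rayIntegrand_le h) (norm_nonneg _)
    (by have := Real.rpow_pos_of_pos hu β; positivity)

lemma integrableOn_rayBound (hβ : 0 < β) (hε : 0 < ε) :
    IntegrableOn (fun u : ℝ => (1 + |x| * u + β * u ^ β) * (Real.exp C * Real.exp (-ε * u ^ β)))
      (Ioi 0) := by
  have h0 := integrableOn_exp_neg_mul_rpow hβ hε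
  have h1 := integrableOn_rpow_mul_exp_neg_mul_rpow (s := 1) (by norm_num) hβ hε
  have h2 := integrableOn_rpow_mul_exp_neg_mul_rpow (s := β) (by linarith) hβ hε
  refine (((h0.add (h1.const_mul |x|)).add (h2.const_mul β)).const_mul (Real.exp C)).congr ?_
  filter_upwards with u
  simp only [Pi.add_apply, Real.rpow_one]
  ring

lemma integral_rayIntegrand_deriv (hβ : 0 < β) (hε : 0 < ε) {θ : ℝ}
    (h : ∀ u, 0 < u → x * u * Real.cos θ - u ^ β * Real.cos (β * θ) ≤ C - ε * u ^ β) :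
    ∫ u in Ioi (0 : ℝ), rayFactor β x θ u * rayIntegrand β x θ u = 0 := by
  have hc := ((continuous_rayIntegrand hβ x).comp (by fun_prop : Continuous fun u : ℝ => (θ, u)))
  have hc' := ((continuous_rayFactor hβ x).comp (by fun_prop : Continuous fun u : ℝ => (θ, u)))
  have key := integral_Ioi_of_hasDerivAt_of_tendsto (f := fun u : ℝ => (u : ℂ) * rayIntegrand β x θ u)
    (f' := fun u : ℝ => rayFactor β x θ u * rayIntegrand β x θ u) (a := 0) (m := 0)
    (Complex.continuous_ofReal.mul hc).continuousWithinAt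
    (fun u hu => hasDerivAt_rayIntegrand_radius β x θ hu)
    (Integrable.mono' (integrableOn_rayBound (C := C) (x := x) hβ hε) (hc'.mul hc).aestronglyMeasurable
      ((ae_restrict_iff' measurableSet_Ioi).2 (.of_forall fun u hu =>
        norm_rayFactor_mul_le hβ hu (h u hu)))) ?_
  · simpa using key
  · have h1 : Filter.Tendsto (fun u : ℝ => Real.exp C * (u * Real.exp (-ε * u ^ β))) Filter.atTop (nhds 0) := by
      -- The boundary term `u exp (-ε u ^ β)` becomes `v ^ (1 / β) exp (-ε v)` with `v = u ^ β`.
      have := (tendsto_rpow_mul_exp_neg_mul_atTop_nhds_zero (1 / β) ε hε).comp (tendsto_rpow_atTop hβ)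
      have h2 := this.const_mul (Real.exp C)
      rw [mul_zero] at h2
      refine h2.congr' ?_
      filter_upwards [Filter.eventually_gt_atTop 0] with u hu
      simp only [Function.comp]
      rw [← Real.rpow_mul hu.le, mul_one_div_cancel hβ.ne', Real.rpow_one]
    refine squeeze_zero_norm' ?_ h1
    filter_upwards [Filter.eventually_gt_atTop 0] with u hu
    rw [norm_mul, Complex.norm_real, Real.norm_eq_abs, abs_of_pos hu]
    have := mul_le_mul_of_nonneg_left (norm_rayIntegrand_le (h u hu)) hu.le
    linarith

/-- The difference of the two ray integrals is the integral over the sector of the angular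
derivative. By Fubini the radial integration can be done first, and it gives zero because the
integrand is a radial total derivative. The bound uniform in `θ` supplies both the integrability and
the vanishing boundary term. -/
lemma integral_rayIntegrand_eq (hβ : 0 < β) (hε : 0 < ε) (hθ : θ₁ ≤ θ₂)
    (h : ∀ θ ∈ Icc θ₁ θ₂, ∀ u, 0 < u →
      x * u * Real.cos θ - u ^ β * Real.cos (β * θ) ≤ C - ε * u ^ β) :
    ∫ u in Ioi (0 : ℝ), rayIntegrand β x θ₁ u = ∫ u in Ioi (0 : ℝ), rayIntegrand β x θ₂ u := by
  have hcD : Continuous fun z : ℝ × ℝ =>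
      Complex.I * (rayFactor β x z.1 z.2 * rayIntegrand β x z.1 z.2) :=
    continuous_const.mul ((continuous_rayFactor hβ x).mul (continuous_rayIntegrand hβ x))
  have hFTC : ∀ u : ℝ, ∫ θ in θ₁..θ₂, Complex.I * (rayFactor β x θ u * rayIntegrand β x θ u) =
      rayIntegrand β x θ₂ u - rayIntegrand β x θ₁ u := fun u =>
    intervalIntegral.integral_eq_sub_of_hasDerivAt
      (fun θ _ => hasDerivAt_rayIntegrand_angle β x θ u)
      ((hcD.comp (by fun_prop : Continuous fun θ : ℝ => (θ, u))).intervalIntegrable _ _)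
  have hint : Integrable (Function.uncurry fun (u θ : ℝ) =>
      Complex.I * (rayFactor β x θ u * rayIntegrand β x θ u))
      ((volume.restrict (Ioi (0 : ℝ))).prod (volume.restrict (Ioc θ₁ θ₂))) := by
    have hB := (integrableOn_rayBound (C := C) (x := x) hβ hε).mul_prod
      (integrable_const (1 : ℝ) (μ := volume.restrict (Ioc θ₁ θ₂)))
    refine Integrable.mono' hB (hcD.comp continuous_swap).aestronglyMeasurable ?_
    rw [Measure.prod_restrict]
    refine (ae_restrict_iff' (measurableSet_Ioi.prod measurableSet_Ioc)).2 (.of_forall ?_)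
    rintro ⟨u, θ⟩ ⟨hu, hθ'⟩
    simp only [Function.uncurry, mul_one]
    rw [norm_mul, Complex.norm_I, one_mul]
    exact norm_rayFactor_mul_le hβ hu (h θ ⟨hθ'.1.le, hθ'.2⟩ u hu)
  have hswap := integral_integral_swap hint
  have hR : ∫ θ in Ioc θ₁ θ₂, ∫ u in Ioi (0 : ℝ),
      Complex.I * (rayFactor β x θ u * rayIntegrand β x θ u) = 0 := by
    rw [setIntegral_congr_fun (g := fun _ => (0 : ℂ)) measurableSet_Ioc]
    · simp
    · intro θ hθ'
      simp only
      rw [integral_const_mul, integral_rayIntegrand_deriv hβ hε (h θ ⟨hθ'.1.le, hθ'.2⟩), mul_zero]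
  rw [hR] at hswap
  simp_rw [← intervalIntegral.integral_of_le hθ, hFTC] at hswap
  rw [integral_sub (integrableOn_rayIntegrand hβ hε (h θ₂ ⟨hθ, le_rfl⟩))
    (integrableOn_rayIntegrand hβ hε (h θ₁ ⟨le_rfl, hθ⟩))] at hswap
  exact (sub_eq_zero.1 hswap).symm

end Rotation

/-! ### The stable characteristic function and one-sidedness of the density -/

lemma cos_mul_pi_div_two_pos {β : ℝ} (hβ0 : 0 < β) (hβ1 : β < 1) :
    0 < Real.cos (β * (Real.pi / 2)) := by
  have := Real.pi_pos
  exact Real.cos_pos_of_mem_Ioo ⟨by nlinarith, by nlinarith⟩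

lemma ofReal_mul_cpow {a : ℝ} (ha : 0 < a) {z : ℂ} (hz : z ≠ 0) (r : ℂ) :
    ((a : ℂ) * z) ^ r = (a : ℂ) ^ r * z ^ r := by
  have ha' : (a : ℂ) ≠ 0 := by exact_mod_cast ha.ne'
  rw [Complex.cpow_def_of_ne_zero (mul_ne_zero ha' hz), Complex.log_ofReal_mul ha hz,
    Complex.cpow_def_of_ne_zero ha', Complex.cpow_def_of_ne_zero hz, ← Complex.exp_add,
    Complex.ofReal_log ha.le]
  ring_nf

/-- The exponent of the extremal stable law is the principal power `(-iκ) ^ β`. -/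
lemma stableExponent_neg_eq_cpow {β : ℝ} (hβ0 : 0 < β) (κ : ℝ) :
    stableExponent β (-β) κ = (-(Complex.I * κ)) ^ (β : ℂ) := by
  have hβ : (β : ℂ) ≠ 0 := by exact_mod_cast hβ0.ne'
  rcases lt_trichotomy κ 0 with h | h | h
  · have hz : (-(Complex.I * κ)) = ((-κ : ℝ) : ℂ) * Complex.I := by push_cast; ring
    have h' : 0 < -κ := by linarith
    rw [hz, ofReal_mul_cpow h' Complex.I_ne_zero, stableExponent, Real.sign_of_neg h,
      abs_of_neg h, Complex.ofReal_cpow h'.le, Complex.cpow_def_of_ne_zero Complex.I_ne_zero,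
      Complex.log_I]
    congr 2
    push_cast
    ring
  · subst h
    simp [stableExponent, hβ, hβ0.ne']
  · have hz : (-(Complex.I * κ)) = ((κ : ℝ) : ℂ) * (-Complex.I) := by ring
    rw [hz, ofReal_mul_cpow h (neg_ne_zero.2 Complex.I_ne_zero), stableExponent, Real.sign_of_pos h,
      abs_of_pos h, Complex.ofReal_cpow h.le,
      Complex.cpow_def_of_ne_zero (neg_ne_zero.2 Complex.I_ne_zero), Complex.log_neg_I]
    congr 2
    push_cast
    ring

lemma re_stableExponent_neg {β : ℝ} (hβ0 : 0 < β) (κ : ℝ) :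
    (stableExponent β (-β) κ).re = |κ| ^ β * Real.cos (β * (Real.pi / 2)) := by
  have h : (Complex.I * ((Real.sign κ * -β * Real.pi / 2 : ℝ) : ℂ)) =
    ((Real.sign κ * -β * Real.pi / 2 : ℝ) : ℂ) * Complex.I := mul_comm _ _
  rw [stableExponent, Complex.re_ofReal_mul, h, Complex.exp_ofReal_mul_I_re]
  rcases lt_trichotomy κ 0 with h | h | h
  · rw [Real.sign_of_neg h]; congr 2; ring
  · subst h; simp [hβ0.ne']
  · rw [Real.sign_of_pos h, ← Real.cos_neg]; congr 2; ring

/-- The characteristic function of the extremal stable law. -/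
noncomputable def stableCharFun (β κ : ℝ) : ℂ := Complex.exp (-stableExponent β (-β) κ)

lemma norm_stableCharFun {β : ℝ} (hβ0 : 0 < β) (κ : ℝ) :
    ‖stableCharFun β κ‖ = Real.exp (-Real.cos (β * (Real.pi / 2)) * |κ| ^ β) := by
  rw [stableCharFun, Complex.norm_exp, Complex.neg_re, re_stableExponent_neg hβ0]
  congr 1
  ring

lemma continuous_stableCharFun {β : ℝ} (hβ0 : 0 < β) : Continuous (stableCharFun β) := by
  have : Continuous fun κ : ℝ => (-(Complex.I * κ)) ^ (β : ℂ) := by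
    refine continuous_iff_continuousAt.2 fun κ => ?_
    exact (Complex.continuousAt_cpow_const_of_re_pos (z := -(Complex.I * κ)) (w := β)
      (by simp) (by simpa using hβ0)).comp
      (f := fun κ : ℝ => (-(Complex.I * κ))) (by fun_prop)
  simp_rw [← stableExponent_neg_eq_cpow hβ0] at this
  exact this.neg.cexp

lemma integrable_of_even {f : ℝ → ℝ} (hf : ∀ x, f (-x) = f x) (h : IntegrableOn f (Ioi 0)) :
    Integrable f := by
  have h1 : IntegrableOn (fun x => f (-x)) (Iio 0) :=
    IntegrableOn.comp_neg_Iio (c := 0) (by rwa [neg_zero])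
  simp_rw [hf] at h1
  rw [← integrableOn_univ, ← Iic_union_Ioi (a := (0 : ℝ))]
  exact (Iff.mpr integrableOn_Iic_iff_integrableOn_Iio h1).union h

lemma integrable_stableCharFun {β : ℝ} (hβ0 : 0 < β) (hβ1 : β < 1) :
    Integrable (stableCharFun β) := by
  have h := integrableOn_exp_neg_mul_rpow hβ0 (cos_mul_pi_div_two_pos hβ0 hβ1)
  have h1 : IntegrableOn (fun κ : ℝ => Real.exp (-Real.cos (β * (Real.pi / 2)) * |κ| ^ β))
      (Ioi 0) := h.congr_fun (fun κ hκ => by simp only [abs_of_pos (mem_Ioi.1 hκ)]) measurableSet_Ioi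
  have h2 := integrable_of_even (fun κ => by rw [abs_neg]) h1
  exact Integrable.mono' h2 (continuous_stableCharFun hβ0).aestronglyMeasurable
    (.of_forall fun κ => (norm_stableCharFun hβ0 κ).le)

lemma stableDensity_integrand_neg {β : ℝ} (x : ℝ) {u : ℝ} (hu : 0 < u) :
    Complex.exp (-(Complex.I * ((-u : ℝ) : ℂ) * x)) * stableCharFun β (-u) =
      -Complex.I * rayIntegrand β x (Real.pi / 2) u := by
  have h1 : Complex.exp (Complex.I * ((Real.pi / 2 : ℝ) : ℂ)) = Complex.I := by
    rw [mul_comm]; push_cast; exact Complex.exp_pi_div_two_mul_I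
  rw [rayIntegrand, h1, stableCharFun, stableExponent, Real.sign_of_neg (by linarith), abs_neg,
    abs_of_pos hu, ← Complex.exp_add, ← mul_assoc, neg_mul Complex.I, Complex.I_mul_I, neg_neg, one_mul]
  congr 1
  push_cast
  ring_nf

/-- Hermitian symmetry: the two half-lines contribute conjugate integrals, so the Fourier integral
is real and a single ray determines it. -/
lemma stableDensity_integrand_conj {β : ℝ} (x u : ℝ) :
    Complex.exp (-(Complex.I * (u : ℂ) * x)) * stableCharFun β u =
      (starRingEnd ℂ) (Complex.exp (-(Complex.I * ((-u : ℝ) : ℂ) * x)) * stableCharFun β (-u)) := by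
  rw [map_mul, stableCharFun, stableCharFun, stableExponent, stableExponent, ← Complex.exp_conj,
    ← Complex.exp_conj, abs_neg, Real.sign_neg]
  simp only [map_neg, map_mul, Complex.conj_I, Complex.conj_ofReal, ← Complex.exp_conj]
  congr 3 <;> push_cast <;> ring_nf

lemma integrable_stableDensity_integrand {β : ℝ} (hβ0 : 0 < β) (hβ1 : β < 1) (x : ℝ) :
    Integrable fun κ : ℝ => Complex.exp (-(Complex.I * κ * x)) * stableCharFun β κ := by
  refine (integrable_stableCharFun hβ0 hβ1).norm.mono' ?_ (.of_forall fun κ => ?_)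
  · exact (Continuous.mul (by fun_prop) (continuous_stableCharFun hβ0)).aestronglyMeasurable
  · rw [norm_mul, Complex.norm_exp]
    simp

lemma stableDensity_integral_eq {β : ℝ} (hβ0 : 0 < β) (hβ1 : β < 1) (x : ℝ) :
    ∫ κ : ℝ, Complex.exp (-(Complex.I * κ * x)) * stableCharFun β κ =
      ((2 * (∫ u in Ioi (0 : ℝ), rayIntegrand β x (Real.pi / 2) u).im : ℝ) : ℂ) := by
  have hi := integrable_stableDensity_integrand hβ0 hβ1 x
  rw [← intervalIntegral.integral_Iic_add_Ioi (b := 0) hi.integrableOn hi.integrableOn]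
  have h1 : ∫ κ in Iic (0 : ℝ), Complex.exp (-(Complex.I * κ * x)) * stableCharFun β κ =
      -Complex.I * ∫ u in Ioi (0 : ℝ), rayIntegrand β x (Real.pi / 2) u := by
    rw [← neg_zero, ← integral_comp_neg_Ioi 0 (fun κ : ℝ =>
      Complex.exp (-(Complex.I * κ * x)) * stableCharFun β κ), ← integral_const_mul, neg_zero]
    exact setIntegral_congr_fun measurableSet_Ioi fun u hu => stableDensity_integrand_neg x hu
  have h2 : ∫ κ in Ioi (0 : ℝ), Complex.exp (-(Complex.I * κ * x)) * stableCharFun β κ =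
      (starRingEnd ℂ) (-Complex.I * ∫ u in Ioi (0 : ℝ), rayIntegrand β x (Real.pi / 2) u) := by
    rw [← integral_const_mul, ← integral_conj]
    refine setIntegral_congr_fun measurableSet_Ioi fun u hu => ?_
    rw [stableDensity_integrand_conj, stableDensity_integrand_neg x hu]
  rw [h1, h2, Complex.add_conj]
  simp

lemma stableDensity_eq_ray {β : ℝ} (hβ0 : 0 < β) (hβ1 : β < 1) (x : ℝ) :
    stableDensity β (-β) x =
      1 / Real.pi * (∫ u in Ioi (0 : ℝ), rayIntegrand β x (Real.pi / 2) u).im := by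
  have := stableDensity_integral_eq hβ0 hβ1 x
  simp only [stableCharFun] at this
  rw [stableDensity, this, Complex.ofReal_re]
  have := Real.pi_pos
  field_simp

/-- The density is its own inverse Fourier integral, without taking real parts. -/
lemma ofReal_stableDensity {β : ℝ} (hβ0 : 0 < β) (hβ1 : β < 1) (x : ℝ) :
    (stableDensity β (-β) x : ℂ) =
      1 / (2 * Real.pi) * ∫ κ : ℝ, Complex.exp (-(Complex.I * κ * x)) * stableCharFun β κ := by
  rw [stableDensity_integral_eq hβ0 hβ1, stableDensity_eq_ray hβ0 hβ1]
  have := Real.pi_ne_zero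
  push_cast
  field_simp

/-- The extremal stable law lives on the positive half-line. -/
lemma stableDensity_of_nonpos {β : ℝ} (hβ0 : 0 < β) (hβ1 : β < 1) {x : ℝ} (hx : x ≤ 0) :
    stableDensity β (-β) x = 0 := by
  have hπ := Real.pi_pos
  rw [stableDensity_eq_ray hβ0 hβ1, ← integral_rayIntegrand_eq (θ₁ := 0) (C := 0) hβ0
    (cos_mul_pi_div_two_pos hβ0 hβ1) (by positivity)]
  · have : ∀ u, rayIntegrand β x 0 u = ((Real.exp (x * u - u ^ β) : ℝ) : ℂ) := fun u => by
      simp [rayIntegrand]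
    simp_rw [this]
    rw [integral_complex_ofReal, Complex.ofReal_im, mul_zero]
  · intro θ hθ u hu
    -- On the quarter-turn `cos θ ≥ 0`, so `x ≤ 0` makes the linear term harmless, and `cos (β θ)`
    -- is smallest at `θ = π / 2`.
    have h1 : 0 ≤ Real.cos θ := Real.cos_nonneg_of_mem_Icc ⟨by linarith [hθ.1], hθ.2⟩
    have h2 : Real.cos (β * (Real.pi / 2)) ≤ Real.cos (β * θ) := by
      refine Real.cos_le_cos_of_nonneg_of_le_pi (mul_nonneg hβ0.le hθ.1) (by nlinarith) ?_
      exact mul_le_mul_of_nonneg_left hθ.2 hβ0.le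
    have h3 := Real.rpow_pos_of_pos hu β
    have h4 : x * u * Real.cos θ ≤ 0 :=
      mul_nonpos_of_nonpos_of_nonneg (mul_nonpos_of_nonpos_of_nonneg hx hu.le) h1
    nlinarith

lemma exists_rpow_le_add_mul {β a ε : ℝ} (hβ0 : 0 < β) (hβ1 : β < 1) (ha : 0 < a) (hε : 0 < ε) :
    ∃ C, ∀ u : ℝ, 0 < u → ε * u ^ β ≤ C + a * u := by
  -- Rescaling by this `k` gives the line `ε k ^ β (1 + u / k)` slope exactly `a`, leaving `v ^ β ≤
  -- 1 + v`.
  set k := (a / ε) ^ (1 / (β - 1)) with hk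
  have hk0 : 0 < k := Real.rpow_pos_of_pos (by positivity) _
  have hk1 : k ^ (β - 1) = a / ε := by
    rw [hk, ← Real.rpow_mul (by positivity), one_div_mul_cancel (by linarith), Real.rpow_one]
  refine ⟨ε * k ^ β, fun u hu => ?_⟩
  have h1 : (u / k) ^ β ≤ 1 + u / k := by
    have h2 : 0 < u / k := by positivity
    rcases le_total (u / k) 1 with h | h
    · have := Real.rpow_le_one h2.le h hβ0.le
      linarith
    · have := Real.rpow_le_rpow_of_exponent_le h hβ1.le
      rw [Real.rpow_one] at this
      linarith
  rw [Real.div_rpow hu.le hk0.le, div_le_iff₀ (Real.rpow_pos_of_pos hk0 _)] at h1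
  have h3 : k ^ β / k = a / ε := by rw [← hk1, Real.rpow_sub_one hk0.ne']
  calc ε * u ^ β ≤ ε * ((1 + u / k) * k ^ β) := by gcongr
    _ = ε * k ^ β + ε * (k ^ β / k) * u := by ring
    _ = ε * k ^ β + a * u := by rw [h3]; field_simp

/-- On the negative axis the factor `exp (x s)` becomes the decaying `exp (-x u)`, which makes
termwise integration of a power series possible. -/
lemma stableDensity_eq_laplace {β : ℝ} (hβ0 : 0 < β) (hβ1 : β < 1) {x : ℝ} (hx : 0 < x) :
    stableDensity β (-β) x = -(1 / Real.pi) *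
      (∫ u in Ioi (0 : ℝ), Complex.exp (-(x * u)) *
        Complex.exp (((u ^ β : ℝ) : ℂ) * (-Complex.exp (Complex.I * (β * Real.pi))))).im := by
  have hπ := Real.pi_pos
  -- This angle exceeds `π / 2` while `β θ₀ < π / 2`. Up to `θ₀` the power term gives decay; beyond
  -- it `cos (β θ)` may be negative, but `cos θ ≤ cos θ₀ < 0` and the linear term dominates.
  set θ₀ := Real.pi / (1 + β) with hθ₀
  have h1 : Real.pi / 2 < θ₀ := by
    rw [hθ₀, div_lt_div_iff₀ (by norm_num) (by linarith)]; nlinarith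
  have h2 : θ₀ < Real.pi := by rw [hθ₀, div_lt_iff₀ (by linarith)]; nlinarith
  have h3 : β * θ₀ < Real.pi / 2 := by
    rw [hθ₀, mul_div_assoc', div_lt_div_iff₀ (by linarith) (by norm_num)]; nlinarith
  have hε : 0 < Real.cos (β * θ₀) := Real.cos_pos_of_mem_Ioo ⟨by nlinarith, h3⟩
  have hc : Real.cos θ₀ < 0 := Real.cos_neg_of_pi_div_two_lt_of_lt h1 (by linarith)
  -- In the coefficient `1 + cos (β θ₀)` the `1` absorbs the worst case of `-cos (β θ)`, and the
  -- rest is the decay rate to be kept.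
  obtain ⟨C, hC⟩ := exists_rpow_le_add_mul (a := -(x * Real.cos θ₀)) (ε := 1 + Real.cos (β * θ₀))
    hβ0 hβ1 (by nlinarith) (by linarith)
  rw [stableDensity_eq_ray hβ0 hβ1, integral_rayIntegrand_eq (θ₂ := Real.pi) (C := max C 0) hβ0
    hε (by linarith)]
  · have : ∀ u, rayIntegrand β x Real.pi u = -(Complex.exp (-(x * u)) *
        Complex.exp (((u ^ β : ℝ) : ℂ) * (-Complex.exp (Complex.I * (β * Real.pi))))) := fun u => by
      have h : Complex.exp (Complex.I * (Real.pi : ℂ)) = -1 := by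
        rw [mul_comm]; exact Complex.exp_pi_mul_I
      rw [rayIntegrand, h, ← Complex.exp_add, neg_one_mul]
      congr 2
      ring
    simp_rw [this]
    rw [integral_neg, Complex.neg_im]
    ring
  · intro θ hθ u hu
    have hu' := Real.rpow_pos_of_pos hu β
    rcases le_total θ θ₀ with h | h
    · have h4 : Real.cos θ ≤ 0 :=
        Real.cos_nonpos_of_pi_div_two_le_of_le hθ.1 (by linarith [hθ.2])
      have h5 : Real.cos (β * θ₀) ≤ Real.cos (β * θ) := by
        refine Real.cos_le_cos_of_nonneg_of_le_pi (mul_nonneg hβ0.le (by linarith [hθ.1]))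
          (by linarith) (mul_le_mul_of_nonneg_left h hβ0.le)
      have h6 : x * u * Real.cos θ ≤ 0 := mul_nonpos_of_nonneg_of_nonpos (by positivity) h4
      nlinarith [le_max_right C 0]
    · have h4 : Real.cos θ ≤ Real.cos θ₀ :=
        Real.cos_le_cos_of_nonneg_of_le_pi (by linarith) hθ.2 h
      have h5 := Real.neg_one_le_cos (β * θ)
      have h6 : x * u * Real.cos θ ≤ x * u * Real.cos θ₀ :=
        mul_le_mul_of_nonneg_left h4 (by positivity)
      nlinarith [le_max_left C 0, hC u hu]

/-! ### Series expansion: the stable density as an `M`-Wright function -/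

/-- Log-convexity of `Γ`, in the form `Γ(a + b) ≤ Γ(a) a ^ b`. -/
lemma Gamma_add_le {a b : ℝ} (ha : 0 < a) (hb0 : 0 < b) (hb1 : b < 1) :
    Real.Gamma (a + b) ≤ Real.Gamma a * a ^ b := by
  have h := Real.Gamma_mul_add_mul_le_rpow_Gamma_mul_rpow_Gamma (s := a) (t := a + 1)
    (a := 1 - b) (b := b) ha (by linarith) (by linarith) hb0 (by ring)
  have hG := Real.Gamma_pos_of_pos ha
  rw [Real.Gamma_add_one ha.ne', Real.mul_rpow ha.le hG.le] at h
  calc Real.Gamma (a + b) = Real.Gamma ((1 - b) * a + b * (a + 1)) := by ring_nf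
    _ ≤ _ := h
    _ = (Real.Gamma a ^ (1 - b) * Real.Gamma a ^ b) * a ^ b := by ring
    _ = _ := by rw [← Real.rpow_add hG]; simp

lemma tendsto_add_one_rpow_sub_one {β : ℝ} (hβ1 : β < 1) :
    Filter.Tendsto (fun n : ℕ => ((n : ℝ) + 1) ^ (β - 1)) Filter.atTop (nhds 0) := by
  have h := tendsto_rpow_neg_atTop (y := 1 - β) (by linarith)
  rw [neg_sub] at h
  exact h.comp (Filter.tendsto_atTop_add_const_right _ 1 tendsto_natCast_atTop_atTop)

/-- Ratio test: by `Gamma_add_le` consecutive terms have ratio at most `|c| (n + 1) ^ (β - 1)`,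
which tends to zero since `β < 1`. -/
lemma summable_Gamma_mul_pow_div_factorial {β : ℝ} (hβ0 : 0 < β) (hβ1 : β < 1) (c : ℝ) :
    Summable fun n : ℕ => Real.Gamma (β * n + 1) * c ^ n / n.factorial := by
  have ht : Filter.Tendsto (fun n : ℕ => |c| * ((n : ℝ) + 1) ^ (β - 1)) Filter.atTop (nhds 0) := by
    simpa using (tendsto_add_one_rpow_sub_one hβ1).const_mul |c|
  refine summable_of_ratio_norm_eventually_le (r := 1 / 2) (by norm_num) ?_
  filter_upwards [ht.eventually_le_const (show (0 : ℝ) < 1 / 2 by norm_num)] with n hn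
  have hp : 0 < β * n + 1 := by positivity
  have hG := Real.Gamma_pos_of_pos hp
  have hG' : 0 < Real.Gamma (β * ((n + 1 : ℕ) : ℝ) + 1) := Real.Gamma_pos_of_pos (by positivity)
  have hle : Real.Gamma (β * ((n + 1 : ℕ) : ℝ) + 1) ≤
      Real.Gamma (β * n + 1) * ((n : ℝ) + 1) ^ β := by
    have h1 : β * ((n + 1 : ℕ) : ℝ) + 1 = β * n + 1 + β := by push_cast; ring
    rw [h1]
    refine (Gamma_add_le hp hβ0 hβ1).trans ?_
    gcongr
    nlinarith [(Nat.cast_nonneg n : (0 : ℝ) ≤ n)]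
  have hn1 : (0 : ℝ) < n + 1 := by positivity
  have hf : (0 : ℝ) < n.factorial := by positivity
  simp only [norm_div, norm_mul, norm_pow, Real.norm_eq_abs, abs_of_pos hG, abs_of_pos hG',
    Nat.abs_cast]
  rw [Nat.factorial_succ, pow_succ]
  push_cast
  rw [Real.rpow_sub_one hn1.ne'] at hn
  calc _ ≤ Real.Gamma (β * n + 1) * ((n : ℝ) + 1) ^ β * (|c| ^ n * |c|) /
        (((n : ℝ) + 1) * n.factorial) := by
          push_cast at hle
          gcongr
    _ = (|c| * (((n : ℝ) + 1) ^ β / (n + 1))) * (Real.Gamma (β * n + 1) * |c| ^ n / n.factorial) := by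
      field_simp
    _ ≤ _ := by gcongr

lemma one_div_Gamma_one_sub {z : ℝ} (hz : 0 < z) :
    1 / Real.Gamma (1 - z) = Real.Gamma z * Real.sin (Real.pi * z) / Real.pi := by
  have h := Real.Gamma_mul_Gamma_one_sub z
  have hG := (Real.Gamma_pos_of_pos hz).ne'
  have h1 : Real.Gamma (1 - z) = Real.pi / Real.sin (Real.pi * z) / Real.Gamma z := by
    rw [← h]; field_simp
  rw [h1]
  rw [one_div_div, div_div_eq_mul_div]

/-- The reflection formula at `z = β (n + 1)`; it holds at the poles too, where the sine vanishes.
-/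
lemma mWright_coeff {β : ℝ} (hβ0 : 0 < β) (n : ℕ) :
    1 / Real.Gamma (-β * n + (1 - β)) =
      Real.Gamma (β * (n + 1)) * Real.sin (Real.pi * (β * (n + 1))) / Real.pi := by
  rw [← one_div_Gamma_one_sub (by positivity)]
  ring_nf

lemma summable_mWright_coeff {β : ℝ} (hβ0 : 0 < β) (hβ1 : β < 1) :
    Summable fun n : ℕ => |1 / ((n.factorial : ℝ) * Real.Gamma (-β * n + (1 - β)))| := by
  have h := ((summable_nat_add_iff 1).2
    (summable_Gamma_mul_pow_div_factorial hβ0 hβ1 1)).mul_left (1 / (β * Real.pi))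
  refine Summable.of_nonneg_of_le (fun _ => abs_nonneg _) (fun n => ?_) h
  have hπ := Real.pi_pos
  have hz : 0 < β * ((n : ℝ) + 1) := by positivity
  have hG := Real.Gamma_pos_of_pos hz
  have hf : (0 : ℝ) < n.factorial := by positivity
  rw [mul_comm, ← div_div, mWright_coeff hβ0, abs_div, abs_div, abs_mul, abs_of_pos hG,
    abs_of_pos hπ, abs_of_pos hf, Nat.factorial_succ]
  push_cast
  rw [Real.Gamma_add_one hz.ne']
  calc _ ≤ Real.Gamma (β * (n + 1)) * 1 / Real.pi / n.factorial := by
        gcongr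
        exact Real.abs_sin_le_one _
    _ = _ := by simp; field_simp

lemma abs_mWright_le {β : ℝ} (hβ0 : 0 < β) (hβ1 : β < 1) :
    ∃ C, ∀ y ∈ Icc (0 : ℝ) 1, |mWright β y| ≤ C := by
  refine ⟨∑' n : ℕ, |1 / ((n.factorial : ℝ) * Real.Gamma (-β * n + (1 - β)))|, fun y hy => ?_⟩
  rw [← Real.norm_eq_abs, mWright, wrightFunction]
  refine tsum_of_norm_bounded (summable_mWright_coeff hβ0 hβ1).hasSum fun n => ?_
  rw [Real.norm_eq_abs, div_eq_mul_one_div, abs_mul, abs_pow, abs_neg, abs_of_nonneg hy.1]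
  exact mul_le_of_le_one_left (abs_nonneg _) (pow_le_one₀ hy.1 hy.2)

lemma stableDensity_hasSum {β : ℝ} (hβ0 : 0 < β) (hβ1 : β < 1) {x : ℝ} (hx : 0 < x) :
    HasSum (fun n : ℕ => (-Complex.exp (Complex.I * (β * Real.pi))) ^ n / n.factorial *
        ((Real.Gamma (β * n + 1) * (1 / x) ^ (β * n + 1) : ℝ) : ℂ))
      (∫ u in Ioi (0 : ℝ), Complex.exp (-(x * u)) *
        Complex.exp (((u ^ β : ℝ) : ℂ) * (-Complex.exp (Complex.I * (β * Real.pi))))) := by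
  set c := -Complex.exp (Complex.I * (β * Real.pi)) with hc
  have hcn : ‖c‖ = 1 := by
    have : Complex.I * (β * Real.pi : ℂ) = ((β * Real.pi : ℝ) : ℂ) * Complex.I := by
      push_cast; ring
    rw [hc, norm_neg, this, Complex.norm_exp_ofReal_mul_I]
  have hI : ∀ n : ℕ, ∫ u in Ioi (0 : ℝ), u ^ (β * n) * Real.exp (-(x * u)) =
      Real.Gamma (β * n + 1) * (1 / x) ^ (β * n + 1) := fun n => by
    have := Real.integral_rpow_mul_exp_neg_mul_Ioi (a := β * n + 1) (r := x) (by positivity) hx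
    rw [add_sub_cancel_right] at this
    rw [this, mul_comm]
  have hInt : ∀ n : ℕ, IntegrableOn (fun u : ℝ => u ^ (β * n) * Real.exp (-(x * u))) (Ioi 0) :=
    fun n => by
      have := integrableOn_rpow_mul_exp_neg_mul_rpow (s := β * n) (p := 1) (b := x)
        (by have : 0 ≤ β * n := by positivity
            linarith) (by norm_num) hx
      simpa using this
  -- The coefficient `c` has modulus one, so the norms integrate to the terms of
  -- `summable_Gamma_mul_pow_div_factorial`.
  have key := hasSum_integral_of_summable_integral_norm (μ := volume.restrict (Ioi (0 : ℝ)))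
    (F := fun (n : ℕ) (u : ℝ) => c ^ n / n.factorial * ((u ^ (β * n) * Real.exp (-(x * u)) : ℝ) : ℂ))
    (fun n => (hInt n).ofReal.const_mul _) ?_
  · simp_rw [integral_const_mul, integral_complex_ofReal, hI] at key
    rw [setIntegral_congr_fun (g := fun u : ℝ => ∑' i : ℕ, c ^ i / (i.factorial : ℂ) *
      ((u ^ (β * i) * Real.exp (-(x * u)) : ℝ) : ℂ)) measurableSet_Ioi]
    · exact key
    intro u hu
    have hu' : 0 < u := hu
    simp only
    have hs : HasSum (fun n : ℕ => (((u ^ β : ℝ) : ℂ) * c) ^ n / (n.factorial : ℂ))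
        (Complex.exp (((u ^ β : ℝ) : ℂ) * c)) := by
      rw [Complex.exp_eq_exp_ℂ]
      exact NormedSpace.expSeries_div_hasSum_exp _
    rw [← hs.tsum_eq, ← tsum_mul_left]
    refine tsum_congr fun n => ?_
    rw [Real.rpow_mul hu'.le, Real.rpow_natCast]
    push_cast
    rw [mul_pow]
    ring
  · have h1 : ∀ n : ℕ, ∫ u in Ioi (0 : ℝ),
        ‖c ^ n / n.factorial * ((u ^ (β * n) * Real.exp (-(x * u)) : ℝ) : ℂ)‖ =
        1 / x * (Real.Gamma (β * n + 1) * ((1 / x) ^ β) ^ n / n.factorial) := fun n => by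
      rw [setIntegral_congr_fun (g := fun u : ℝ => 1 / n.factorial *
        (u ^ (β * n) * Real.exp (-(x * u)))) measurableSet_Ioi]
      · rw [integral_const_mul, hI, Real.rpow_add_one (by positivity), Real.rpow_mul (by positivity),
          Real.rpow_natCast]
        ring
      · intro u hu
        have hu' : 0 < u := hu
        have : 0 < u ^ (β * n) * Real.exp (-(x * u)) := by positivity
        simp only
        rw [norm_mul, norm_div, norm_pow, hcn, one_pow, Complex.norm_real,
          Real.norm_eq_abs, abs_of_pos this, Complex.norm_natCast]
    simp_rw [h1]
    exact (summable_Gamma_mul_pow_div_factorial hβ0 hβ1 _).mul_left _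

/-- The extremal stable density in terms of the `M`-Wright function. -/
lemma stableDensity_eq_mWright {β : ℝ} (hβ0 : 0 < β) (hβ1 : β < 1) {x : ℝ} (hx : 0 < x) :
    stableDensity β (-β) x = β * x ^ (-β - 1) * mWright β (x ^ (-β)) := by
  have hπ := Real.pi_pos
  have h := (Complex.hasSum_im (stableDensity_hasSum hβ0 hβ1 hx)).mul_left (-(1 / Real.pi))
  -- The term `n = 0` is real and drops out; the index shift matches `Γ(β (n + 1))` with the `n`-th
  -- Wright coefficient.
  rw [← stableDensity_eq_laplace hβ0 hβ1 hx, ← hasSum_nat_add_iff' 1] at h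
  have h0 : ∀ n : ℕ, ((-Complex.exp (Complex.I * (β * Real.pi))) ^ n / n.factorial *
        ((Real.Gamma (β * n + 1) * (1 / x) ^ (β * n + 1) : ℝ) : ℂ)).im =
      (-1) ^ n * Real.sin (Real.pi * (β * n)) / n.factorial *
        (Real.Gamma (β * n + 1) * (1 / x) ^ (β * n + 1)) := fun n => by
    have h1 : (-Complex.exp (Complex.I * (β * Real.pi))) ^ n / (n.factorial : ℂ) =
        (((-1) ^ n / n.factorial : ℝ) : ℂ) *
          Complex.exp (((Real.pi * (β * n) : ℝ) : ℂ) * Complex.I) := by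
      rw [neg_pow, ← Complex.exp_nat_mul]
      push_cast
      ring_nf
    rw [Complex.im_mul_ofReal, h1, Complex.im_ofReal_mul, Complex.exp_ofReal_mul_I_im]
    ring
  simp only [h0, Finset.range_one, Finset.sum_singleton, Nat.cast_zero, mul_zero, Real.sin_zero,
    zero_div, zero_mul, sub_zero] at h
  rw [← h.tsum_eq, mWright, wrightFunction, ← tsum_mul_left]
  refine tsum_congr fun n => ?_
  have hz : 0 < β * ((n : ℝ) + 1) := by positivity
  have h2 : (-x ^ (-β)) ^ n / ((n.factorial : ℝ) * Real.Gamma (-β * n + (1 - β))) =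
      (-x ^ (-β)) ^ n / n.factorial * (1 / Real.Gamma (-β * n + (1 - β))) := by
    rw [div_mul_div_comm, mul_one]
  have h3 : (1 / x) ^ (β * ((n : ℝ) + 1) + 1) = (x ^ (-β)) ^ n * x ^ (-β - 1) := by
    rw [one_div, Real.inv_rpow hx.le, ← Real.rpow_neg hx.le, ← Real.rpow_natCast, ← Real.rpow_mul hx.le,
      ← Real.rpow_add hx]
    ring_nf
  rw [h2, mWright_coeff hβ0, Nat.factorial_succ]
  push_cast
  rw [Real.Gamma_add_one hz.ne', h3, neg_pow (x ^ (-β))]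
  have hf : (0 : ℝ) < n.factorial := by positivity
  field_simp
  ring

/-! ### Integrability of the density and Fourier inversion -/

lemma continuous_stableDensity {β : ℝ} (hβ0 : 0 < β) (hβ1 : β < 1) :
    Continuous (stableDensity β (-β)) := by
  have h : Continuous fun x : ℝ =>
      ∫ κ : ℝ, Complex.exp (-(Complex.I * κ * x)) * stableCharFun β κ := by
    refine continuous_of_dominated (bound := fun κ => ‖stableCharFun β κ‖)
      (fun x => (integrable_stableDensity_integrand hβ0 hβ1 x).aestronglyMeasurable)
      (fun x => .of_forall fun κ => ?_) (integrable_stableCharFun hβ0 hβ1).norm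
      (.of_forall fun κ => by fun_prop)
    rw [norm_mul, Complex.norm_exp]
    simp
  exact continuous_const.mul (Complex.continuous_re.comp h)

lemma integrable_stableDensity {β : ℝ} (hβ0 : 0 < β) (hβ1 : β < 1) :
    Integrable (stableDensity β (-β)) := by
  have hc := continuous_stableDensity hβ0 hβ1
  have h1 : IntegrableOn (stableDensity β (-β)) (Iic 0) :=
    integrableOn_zero.congr_fun (fun x hx => (stableDensity_of_nonpos hβ0 hβ1 hx).symm)
      measurableSet_Iic
  have h2 : IntegrableOn (stableDensity β (-β)) (Icc 0 1) := hc.integrableOn_Icc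
  have h3 : IntegrableOn (stableDensity β (-β)) (Ioi 1) := by
    -- For `x > 1` the argument `x ^ (-β)` lies in `[0, 1]`, so the density is `O(x ^ (-β - 1))`.
    obtain ⟨C, hC⟩ := abs_mWright_le hβ0 hβ1
    refine Integrable.mono' ((integrableOn_Ioi_rpow_of_lt (a := -β - 1) (c := 1) (by linarith)
      one_pos).mul_const (β * C)) hc.aestronglyMeasurable
      ((ae_restrict_iff' measurableSet_Ioi).2 (.of_forall fun x hx => ?_))
    have hx1 : (1 : ℝ) < x := hx
    have hx0 : 0 < x := by linarith
    have hp : 0 < x ^ (-β - 1) := Real.rpow_pos_of_pos hx0 _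
    rw [stableDensity_eq_mWright hβ0 hβ1 hx0, Real.norm_eq_abs, abs_mul, abs_mul, abs_of_pos hβ0,
      abs_of_pos hp]
    have := hC (x ^ (-β)) ⟨(Real.rpow_pos_of_pos hx0 _).le,
      Real.rpow_le_one_of_one_le_of_nonpos hx1.le (by linarith)⟩
    calc _ ≤ β * x ^ (-β - 1) * C := by gcongr
      _ = _ := by ring
  rw [← integrableOn_univ, show (univ : Set ℝ) = Iic 0 ∪ (Icc 0 1 ∪ Ioi 1) by
    rw [Icc_union_Ioi_eq_Ici zero_le_one, Iic_union_Ici]]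
  exact h1.union (h2.union h3)

/-- The Fourier transform of the extremal stable density. -/
lemma integral_exp_mul_stableDensity {β : ℝ} (hβ0 : 0 < β) (hβ1 : β < 1) (κ : ℝ) :
    ∫ x : ℝ, Complex.exp (Complex.I * κ * x) * (stableDensity β (-β) x : ℂ) =
      stableCharFun β κ := by
  have hπ := Real.pi_pos
  -- The kernel `exp (-2π i v w)` of `FourierTransform.fourier` accounts for the argument `2π w` and
  -- the prefactor `2π`.
  have hF : ∀ w : ℝ, FourierTransform.fourier (stableCharFun β) w =
      2 * Real.pi * (stableDensity β (-β) (2 * Real.pi * w) : ℂ) := fun w => by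
    rw [ofReal_stableDensity hβ0 hβ1, Real.fourier_real_eq_integral_exp_smul]
    rw [← mul_assoc, mul_one_div_cancel (by simp), one_mul]
    congr 1 with v
    rw [smul_eq_mul]
    congr 2
    push_cast
    ring
  have hF' : FourierTransform.fourier (stableCharFun β) = fun w : ℝ =>
      2 * Real.pi * (stableDensity β (-β) (2 * Real.pi * w) : ℂ) := funext hF
  have hi : Integrable (FourierTransform.fourier (stableCharFun β)) := by
    rw [hF']
    exact (((integrable_stableDensity hβ0 hβ1).comp_mul_left' (by positivity)).ofReal).const_mul _
  have h := (integrable_stableCharFun hβ0 hβ1).fourierInv_fourier_eq hi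
    (continuous_stableCharFun hβ0).continuousAt (v := κ)
  rw [← h, Real.fourierInv_eq', hF']
  have h2 := Measure.integral_comp_mul_left (fun x : ℝ =>
    Complex.exp (Complex.I * κ * x) * (stableDensity β (-β) x : ℂ)) (2 * Real.pi)
  rw [abs_of_pos (by positivity), eq_inv_smul_iff₀ (by positivity)] at h2
  rw [← h2, ← integral_smul]
  congr 1 with v
  rw [smul_eq_mul, Complex.real_smul]
  have : Complex.I * κ * ((2 * Real.pi * v : ℝ) : ℂ) =
      ((2 * Real.pi * inner ℝ v κ : ℝ) : ℂ) * Complex.I := by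
    simp
    ring
  rw [this]
  push_cast
  ring

/-! ### Laplace transform of the extremal density -/

lemma mul_exp_neg_mul_le {a x : ℝ} (ha : 0 < a) : x * Real.exp (-(a * x)) ≤ 1 / a := by
  have h := Real.add_one_le_exp (a * x)
  rw [Real.exp_neg, ← div_eq_mul_inv, div_le_div_iff₀ (Real.exp_pos _) ha]
  linarith

/-- Differentiation of a Laplace integral under the integral sign. -/
lemma hasDerivAt_laplace {f : ℝ → ℂ} (hf : IntegrableOn f (Ioi 0)) {s : ℂ} (hs : 0 < s.re) :
    IntegrableOn (fun x : ℝ => -(x : ℂ) * (Complex.exp (-(s * x)) * f x)) (Ioi 0) ∧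
    HasDerivAt (fun s : ℂ => ∫ x in Ioi (0 : ℝ), Complex.exp (-(s * x)) * f x)
      (∫ x in Ioi (0 : ℝ), -(x : ℂ) * (Complex.exp (-(s * x)) * f x)) s := by
  have hm : ∀ z : ℂ, AEStronglyMeasurable (fun x : ℝ => Complex.exp (-(z * x)) * f x)
      (volume.restrict (Ioi 0)) := fun z =>
    (Continuous.aestronglyMeasurable (by fun_prop)).mul hf.aestronglyMeasurable
  -- On this half-plane `x exp (-x Re z)` is at most `2 / Re s`, a bound independent of `z`.
  have hopen : {z : ℂ | s.re / 2 < z.re} ∈ nhds s :=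
    (isOpen_lt continuous_const Complex.continuous_re).mem_nhds (half_lt_self hs)
  refine hasDerivAt_integral_of_dominated_loc_of_deriv_le
    (F := fun (z : ℂ) (x : ℝ) => Complex.exp (-(z * x)) * f x)
    (F' := fun (z : ℂ) (x : ℝ) => -(x : ℂ) * (Complex.exp (-(z * x)) * f x))
    (bound := fun x => 1 / (s.re / 2) * ‖f x‖) hopen (.of_forall hm) ?_ ?_ ?_ ?_ ?_
  · refine hf.norm.mono' (hm s) ((ae_restrict_iff' measurableSet_Ioi).2 (.of_forall fun x hx => ?_))
    rw [norm_mul, Complex.norm_exp]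
    refine mul_le_of_le_one_left (norm_nonneg _) (Real.exp_le_one_iff.2 ?_)
    have : 0 < s.re * x := mul_pos hs hx
    simpa using this.le
  · exact (Continuous.aestronglyMeasurable (by fun_prop)).mul (hm s)
  · refine (ae_restrict_iff' measurableSet_Ioi).2 (.of_forall fun x hx z hz => ?_)
    have hx' : 0 < x := hx
    have hz' : s.re / 2 < z.re := hz
    rw [norm_mul, norm_mul, norm_neg, Complex.norm_real, Real.norm_eq_abs, abs_of_pos hx',
      Complex.norm_exp, ← mul_assoc]
    refine mul_le_mul_of_nonneg_right (le_trans ?_ (mul_exp_neg_mul_le (x := x) (half_pos hs)))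
      (norm_nonneg _)
    refine mul_le_mul_of_nonneg_left (Real.exp_le_exp.2 ?_) hx'.le
    simp
    nlinarith
  · exact hf.norm.const_mul _
  · refine .of_forall fun x z _ => ?_
    have h : HasDerivAt (fun z : ℂ => -(z * x)) (-(x : ℂ)) z := by
      simpa using! ((hasDerivAt_id z).mul_const (x : ℂ)).neg
    exact (h.cexp.mul_const (f x)).congr_deriv (by ring)

/-- The argument of `s ^ β` is at most `β π / 2 < π / 2` in absolute value. -/
lemma re_cpow_pos {β : ℝ} (hβ0 : 0 < β) (hβ1 : β < 1) {s : ℂ} (hs : 0 ≤ s.re) (h0 : s ≠ 0) :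
    0 < (s ^ (β : ℂ)).re := by
  rw [Complex.cpow_def_of_ne_zero h0, Complex.exp_re]
  refine mul_pos (Real.exp_pos _) (Real.cos_pos_of_mem_Ioo ?_)
  rw [Complex.im_mul_ofReal, Complex.log_im]
  have h := abs_le.1 (Complex.abs_arg_le_pi_div_two_iff.2 hs)
  have hπ := Real.pi_pos
  constructor <;> nlinarith [h.1, h.2]

lemma norm_exp_neg_mul_le_one {s : ℂ} (hs : 0 ≤ s.re) {x : ℝ} (hx : 0 ≤ x) :
    ‖Complex.exp (-(s * x))‖ ≤ 1 := by
  rw [Complex.norm_exp]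
  refine Real.exp_le_one_iff.2 ?_
  have : 0 ≤ s.re * x := mul_nonneg hs hx
  simpa using this

lemma integrableOn_exp_neg_mul {f : ℝ → ℂ} (hf : IntegrableOn f (Ioi 0)) {s : ℂ} (hs : 0 ≤ s.re) :
    IntegrableOn (fun x : ℝ => Complex.exp (-(s * x)) * f x) (Ioi 0) := by
  refine hf.norm.mono' ((Continuous.aestronglyMeasurable (by fun_prop)).mul hf.aestronglyMeasurable)
    ((ae_restrict_iff' measurableSet_Ioi).2 (.of_forall fun x hx => ?_))
  rw [norm_mul]
  exact mul_le_of_le_one_left (norm_nonneg _) (norm_exp_neg_mul_le_one hs (le_of_lt hx))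

/-- The Laplace transform of the extremal stable density. -/
lemma laplace_stableDensity {β : ℝ} (hβ0 : 0 < β) (hβ1 : β < 1) {s : ℂ} (hs : 0 ≤ s.re) :
    ∫ x in Ioi (0 : ℝ), Complex.exp (-(s * x)) * (stableDensity β (-β) x : ℂ) =
      Complex.exp (-s ^ (β : ℂ)) := by
  have hfi : Integrable (fun x => (stableDensity β (-β) x : ℂ)) :=
    (integrable_stableDensity hβ0 hβ1).ofReal
  have hf := hfi.integrableOn (s := Ioi 0)
  set G : ℂ → ℂ := fun s => ∫ x in Ioi (0 : ℝ), Complex.exp (-(s * x)) * (stableDensity β (-β) x : ℂ)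
    with hG
  set K := ∫ x in Ioi (0 : ℝ), ‖(stableDensity β (-β) x : ℂ)‖ with hK
  have hGle : ∀ z : ℂ, 0 ≤ z.re → ‖G z‖ ≤ K := fun z hz => by
    refine norm_integral_le_of_norm_le hf.norm
      ((ae_restrict_iff' measurableSet_Ioi).2 (.of_forall fun x hx => ?_))
    rw [norm_mul]
    exact mul_le_of_le_one_left (norm_nonneg _) (norm_exp_neg_mul_le_one hz (le_of_lt hx))
  have hEle : ∀ z : ℂ, 0 ≤ z.re → ‖Complex.exp (-z ^ (β : ℂ))‖ ≤ 1 := fun z hz => by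
    rw [Complex.norm_exp, Complex.neg_re]
    refine Real.exp_le_one_iff.2 (neg_nonpos.2 ?_)
    by_cases h0 : z = 0
    · simp [h0, Complex.zero_cpow (show (β : ℂ) ≠ 0 by exact_mod_cast hβ0.ne')]
    · exact (re_cpow_pos hβ0 hβ1 hz h0).le
  have hcl : closure {z : ℂ | 0 < z.re} = {z : ℂ | 0 ≤ z.re} := Complex.closure_setOfPred_lt_re 0
  have hD : DiffContOnCl ℂ (fun z => G z - Complex.exp (-z ^ (β : ℂ))) {z | 0 < z.re} := by
    refine ⟨fun z hz => ?_, ?_⟩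
    · refine DifferentiableAt.differentiableWithinAt
        ((hasDerivAt_laplace hf hz).2.differentiableAt.sub ?_)
      exact ((hasDerivAt_id z).cpow_const (Or.inl hz)).differentiableAt.neg.cexp
    · rw [hcl]
      refine ContinuousOn.sub ?_ ?_
      · refine continuousOn_of_dominated (bound := fun x => ‖(stableDensity β (-β) x : ℂ)‖)
          (fun z hz => (integrableOn_exp_neg_mul hf hz).aestronglyMeasurable) (fun z hz => ?_) hf.norm
          (.of_forall fun x => by fun_prop)
        refine (ae_restrict_iff' measurableSet_Ioi).2 (.of_forall fun x hx => ?_)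
        rw [norm_mul]
        exact mul_le_of_le_one_left (norm_nonneg _) (norm_exp_neg_mul_le_one hz (le_of_lt hx))
      · intro z hz
        exact (Complex.continuousAt_cpow_const_of_re_pos (Or.inl hz)
          (by simpa using hβ0)).neg.cexp.continuousWithinAt
  have hle : ∀ z : ℂ, 0 ≤ z.re → ‖G z - Complex.exp (-z ^ (β : ℂ))‖ ≤ K + 1 := fun z hz =>
    (norm_sub_le _ _).trans (add_le_add (hGle z hz) (hEle z hz))
  -- The difference of the two sides is bounded on the closed half-plane and zero on the imaginary
  -- axis, so the bound `C = 0` propagates inward. Growth exponent `1` with constant `0` encodes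
  -- boundedness.
  have hzero := PhragmenLindelof.right_half_plane_of_bounded_on_real (C := 0) hD
    ⟨1, by norm_num, 0, ?_⟩ ?_ ?_ hs
  · exact sub_eq_zero.1 (norm_le_zero_iff.1 hzero)
  · refine Asymptotics.IsBigO.of_bound (K + 1) ?_
    refine Filter.eventually_inf_principal.2 (.of_forall fun z hz => ?_)
    simpa using hle z (le_of_lt hz)
  · refine Filter.isBoundedUnder_of_eventually_le (a := K + 1) ?_
    filter_upwards [Filter.eventually_ge_atTop 0] with x hx
    exact hle x (by simpa using hx)
  · intro x
    rw [norm_le_zero_iff, sub_eq_zero]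
    -- On the imaginary axis the claim is Fourier inversion at frequency `-x`; the negative
    -- half-line contributes nothing.
    have h := integral_exp_mul_stableDensity hβ0 hβ1 (-x)
    have hi : Integrable fun y : ℝ => Complex.exp (Complex.I * ((-x : ℝ) : ℂ) * y) *
        (stableDensity β (-β) y : ℂ) := by
      refine hfi.norm.mono' ((Continuous.aestronglyMeasurable (by fun_prop)).mul
        hfi.aestronglyMeasurable) (.of_forall fun y => ?_)
      rw [norm_mul, Complex.norm_exp]
      simp
    rw [← intervalIntegral.integral_Iic_add_Ioi (b := 0) hi.integrableOn hi.integrableOn,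
      setIntegral_congr_fun (g := fun _ => (0 : ℂ)) measurableSet_Iic (fun y hy => by
        simp only [stableDensity_of_nonpos hβ0 hβ1 hy, Complex.ofReal_zero, mul_zero]),
      integral_zero, zero_add, stableCharFun, stableExponent_neg_eq_cpow hβ0] at h
    have h1 : -(Complex.I * ((-x : ℝ) : ℂ)) = x * Complex.I := by push_cast; ring
    rw [h1] at h
    rw [← h, hG]
    refine setIntegral_congr_fun measurableSet_Ioi fun y _ => ?_
    congr 2
    push_cast
    ring

/-! ### The scaled densities and their Laplace transforms in `t` -/

lemma rDensity_eq {β τ : ℝ} (hτ : 0 < τ) (t : ℝ) :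
    rDensity β t τ = (τ ^ (1 / β))⁻¹ * stableDensity β (-β) ((τ ^ (1 / β))⁻¹ * t) := by
  rw [rDensity, neg_div, Real.rpow_neg hτ.le, div_eq_inv_mul t]

lemma rDensity_of_nonpos {β τ t : ℝ} (hβ0 : 0 < β) (hβ1 : β < 1) (hτ : 0 < τ) (ht : t ≤ 0) :
    rDensity β t τ = 0 := by
  rw [rDensity_eq hτ, stableDensity_of_nonpos hβ0 hβ1, mul_zero]
  exact mul_nonpos_of_nonneg_of_nonpos (by positivity) ht

lemma continuous_rDensity {β τ : ℝ} (hβ0 : 0 < β) (hβ1 : β < 1) (hτ : 0 < τ) :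
    Continuous fun t => rDensity β t τ := by
  simp_rw [rDensity_eq hτ]
  exact continuous_const.mul ((continuous_stableDensity hβ0 hβ1).comp (by fun_prop))

lemma integrable_rDensity {β τ : ℝ} (hβ0 : 0 < β) (hβ1 : β < 1) (hτ : 0 < τ) :
    Integrable fun t => rDensity β t τ := by
  simp_rw [rDensity_eq hτ]
  exact ((integrable_stableDensity hβ0 hβ1).comp_mul_left' (by positivity)).const_mul _

lemma laplace_rDensity {β τ : ℝ} (hβ0 : 0 < β) (hβ1 : β < 1) (hτ : 0 < τ) {s : ℂ} (hs : 0 ≤ s.re) :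
    ∫ t in Ioi (0 : ℝ), Complex.exp (-(s * t)) * (rDensity β t τ : ℂ) =
      Complex.exp (-(τ * s ^ (β : ℂ))) := by
  set c := τ ^ (1 / β) with hc
  have hc0 : 0 < c := by positivity
  have hcβ : (c : ℂ) ^ (β : ℂ) = τ := by
    rw [← Complex.ofReal_cpow hc0.le, hc, ← Real.rpow_mul hτ.le, one_div_mul_cancel hβ0.ne',
      Real.rpow_one]
  have h := laplace_stableDensity hβ0 hβ1 (s := c * s)
    (by simpa using mul_nonneg hc0.le hs)
  have h2 := integral_comp_mul_left_Ioi (fun x : ℝ => Complex.exp (-(c * s * x)) *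
    (stableDensity β (-β) x : ℂ)) 0 (inv_pos.2 hc0)
  rw [mul_zero, inv_inv, h] at h2
  have h3 : (c * s) ^ (β : ℂ) = τ * s ^ (β : ℂ) := by
    by_cases h0 : s = 0
    · simp [h0, Complex.zero_cpow (show (β : ℂ) ≠ 0 by exact_mod_cast hβ0.ne')]
    · rw [ofReal_mul_cpow hc0 h0, hcβ]
  rw [h3, ← inv_smul_eq_iff₀ hc0.ne', ← integral_smul] at h2
  rw [← h2]
  refine setIntegral_congr_fun measurableSet_Ioi fun t _ => ?_
  have hcc : (c : ℂ) ≠ 0 := by exact_mod_cast hc0.ne'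
  have h4 : (c : ℂ) * s * ((c⁻¹ * t : ℝ) : ℂ) = s * t := by
    push_cast
    field_simp
  rw [rDensity_eq hτ, ← hc, h4, Complex.real_smul]
  push_cast
  ring

lemma rDensity_eq_qDensity {β t τ : ℝ} (hβ0 : 0 < β) (hβ1 : β < 1) (ht : 0 < t) (hτ : 0 < τ) :
    rDensity β t τ = β * τ / t * qDensity β τ t := by
  have hc0 : 0 < τ ^ (1 / β) := by positivity
  have h1 : ((τ ^ (1 / β))⁻¹ * t) ^ (-β) = τ / t ^ β := by
    rw [Real.mul_rpow (by positivity) ht.le, Real.inv_rpow hc0.le, Real.rpow_neg hc0.le, inv_inv,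
      ← Real.rpow_mul hτ.le, one_div_mul_cancel hβ0.ne', Real.rpow_one, Real.rpow_neg ht.le,
      div_eq_mul_inv]
  rw [rDensity_eq hτ, stableDensity_eq_mWright hβ0 hβ1 (by positivity),
    Real.rpow_sub_one (by positivity), h1, qDensity, Real.rpow_neg ht.le]
  field_simp

lemma qDensity_eq_rDensity {β t τ : ℝ} (hβ0 : 0 < β) (hβ1 : β < 1) (ht : 0 < t) (hτ : 0 < τ) :
    qDensity β τ t = t / (β * τ) * rDensity β t τ := by
  rw [rDensity_eq_qDensity hβ0 hβ1 ht hτ]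
  field_simp

lemma hasLaplaceAt_rDensity {β τ : ℝ} (hβ0 : 0 < β) (hβ1 : β < 1) (hτ : 0 < τ) {s : ℂ}
    (hs : 0 ≤ s.re) :
    HasLaplaceAt (fun t => (rDensity β t τ : ℂ)) s (Complex.exp (-(τ * s ^ (β : ℂ)))) :=
  ⟨integrableOn_exp_neg_mul (integrable_rDensity hβ0 hβ1 hτ).ofReal.integrableOn hs,
    laplace_rDensity hβ0 hβ1 hτ hs⟩

/-- Since `q = t / (β τ) r`, its transform is `-1 / (β τ)` times the `s`-derivative of `exp (-τ s ^
β)`. -/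
lemma hasLaplaceAt_qDensity {β τ : ℝ} (hβ0 : 0 < β) (hβ1 : β < 1) (hτ : 0 < τ) {s : ℂ}
    (hs : 0 < s.re) :
    HasLaplaceAt (fun t => (qDensity β τ t : ℂ)) s
      (s ^ ((β : ℂ) - 1) * Complex.exp (-(τ * s ^ (β : ℂ)))) := by
  have hf : IntegrableOn (fun t => (rDensity β t τ : ℂ)) (Ioi 0) :=
    (integrable_rDensity hβ0 hβ1 hτ).ofReal.integrableOn
  obtain ⟨hi, hd⟩ := hasDerivAt_laplace hf hs
  have heq : EqOn (fun t : ℝ => -(1 / (β * τ) : ℂ) * (-(t : ℂ) * (Complex.exp (-(s * t)) *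
      (rDensity β t τ : ℂ)))) (fun t : ℝ => Complex.exp (-(s * t)) * (qDensity β τ t : ℂ)) (Ioi 0) := by
    intro t ht
    simp only
    rw [qDensity_eq_rDensity hβ0 hβ1 ht hτ]
    push_cast
    ring
  refine ⟨IntegrableOn.congr_fun (hi.const_mul _) heq measurableSet_Ioi, ?_⟩
  rw [← setIntegral_congr_fun measurableSet_Ioi heq, integral_const_mul]
  have hd2 : HasDerivAt (fun s : ℂ => Complex.exp (-(τ * s ^ (β : ℂ))))
      (Complex.exp (-(τ * s ^ (β : ℂ))) * -(τ * (β * s ^ ((β : ℂ) - 1) * 1))) s :=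
    (((hasDerivAt_id s).cpow_const (Or.inl hs)).const_mul (τ : ℂ)).neg.cexp
  have hev : (fun s : ℂ => ∫ t in Ioi (0 : ℝ), Complex.exp (-(s * t)) * (rDensity β t τ : ℂ)) =ᶠ[nhds s]
      fun s : ℂ => Complex.exp (-(τ * s ^ (β : ℂ))) := by
    filter_upwards [(isOpen_lt continuous_const Complex.continuous_re).mem_nhds hs] with z hz
    exact laplace_rDensity hβ0 hβ1 hτ (le_of_lt hz)
  rw [hd.unique (hd2.congr_of_eventuallyEq hev)]
  have h1 : (β : ℂ) ≠ 0 := by exact_mod_cast hβ0.ne'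
  have h2 : (τ : ℂ) ≠ 0 := by exact_mod_cast hτ.ne'
  field_simp

/-! ### Change of variables and moments of `M` -/

section ScaleIntegral

variable {E : Type*} [NormedAddCommGroup E] [NormedSpace ℝ E]

lemma integral_Ioi_scale (g : ℝ → E) {b : ℝ} (hb : 0 < b) :
    ∫ x in Ioi (0 : ℝ), b • g (b * x) = ∫ x in Ioi (0 : ℝ), g x := by
  rw [integral_smul, integral_comp_mul_left_Ioi g 0 hb, mul_zero, smul_inv_smul₀ hb.ne']

lemma integrableOn_Ioi_scale {g : ℝ → E} {b : ℝ} (hb : 0 < b) (hg : IntegrableOn g (Ioi 0)) :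
    IntegrableOn (fun x => b • g (b * x)) (Ioi 0) := by
  refine Integrable.smul b ?_
  have := (integrableOn_Ioi_comp_mul_left_iff g 0 hb).2 (by rwa [mul_zero])
  exact this

end ScaleIntegral

/-- The substitution `y = x ^ (-β)`: if `X` has density `L`, then `X ^ (-β)` has density `M`. -/
lemma integral_stableDensity_smul {β : ℝ} (hβ0 : 0 < β) (hβ1 : β < 1) (g : ℝ → ℂ) :
    ∫ y in Ioi (0 : ℝ), (mWright β y : ℂ) * g y =
      ∫ x in Ioi (0 : ℝ), (stableDensity β (-β) x : ℂ) * g (x ^ (-β)) := by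
  rw [← integral_comp_rpow_Ioi _ (neg_ne_zero.2 hβ0.ne')]
  refine setIntegral_congr_fun measurableSet_Ioi fun x hx => ?_
  have hx' : 0 < x := hx
  rw [stableDensity_eq_mWright hβ0 hβ1 hx', abs_neg, abs_of_pos hβ0, Complex.real_smul]
  push_cast
  ring

lemma integrableOn_mWright_mul_iff {β : ℝ} (hβ0 : 0 < β) (hβ1 : β < 1) (g : ℝ → ℝ) :
    IntegrableOn (fun y => mWright β y * g y) (Ioi 0) ↔
      IntegrableOn (fun x => stableDensity β (-β) x * g (x ^ (-β))) (Ioi 0) := by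
  rw [← integrableOn_Ioi_comp_rpow_iff _ (neg_ne_zero.2 hβ0.ne')]
  refine integrableOn_congr_fun (fun x hx => ?_) measurableSet_Ioi
  have hx' : 0 < x := hx
  rw [stableDensity_eq_mWright hβ0 hβ1 hx', abs_neg, abs_of_pos hβ0, smul_eq_mul]
  ring

lemma integral_mWright_mul {β : ℝ} (hβ0 : 0 < β) (hβ1 : β < 1) (g : ℝ → ℝ) :
    ∫ y in Ioi (0 : ℝ), mWright β y * g y =
      ∫ x in Ioi (0 : ℝ), stableDensity β (-β) x * g (x ^ (-β)) := by
  have h := integral_stableDensity_smul hβ0 hβ1 (fun y => (g y : ℂ))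
  simp_rw [← Complex.ofReal_mul, integral_complex_ofReal] at h
  exact_mod_cast h

lemma real_laplace_stableDensity {β : ℝ} (hβ0 : 0 < β) (hβ1 : β < 1) {s : ℝ} (hs : 0 ≤ s) :
    ∫ x in Ioi (0 : ℝ), Real.exp (-(s * x)) * stableDensity β (-β) x = Real.exp (-s ^ β) := by
  have h := laplace_stableDensity hβ0 hβ1 (s := (s : ℂ)) (by simpa using hs)
  rw [← Complex.ofReal_cpow hs] at h
  simp_rw [← Complex.ofReal_mul, ← Complex.ofReal_neg, ← Complex.ofReal_exp, ← Complex.ofReal_mul,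
    integral_complex_ofReal] at h
  exact_mod_cast h

lemma mWright_eq {β : ℝ} (hβ0 : 0 < β) (hβ1 : β < 1) {y : ℝ} (hy : 0 < y) :
    mWright β y = 1 / β * y ^ (-(1 + 1 / β)) * stableDensity β (-β) (y ^ (-(1 / β))) := by
  have h1 : (y ^ (-(1 / β))) ^ (-β) = y := by
    rw [← Real.rpow_mul hy.le, show -(1 / β) * -β = 1 by field_simp, Real.rpow_one]
  have h2 : y ^ (-(1 + 1 / β)) * (y ^ (-(1 / β))) ^ (-β - 1) = 1 := by
    rw [← Real.rpow_mul hy.le, ← Real.rpow_add hy,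
      show -(1 + 1 / β) + -(1 / β) * (-β - 1) = 0 by field_simp; ring, Real.rpow_zero]
  rw [stableDensity_eq_mWright hβ0 hβ1 (by positivity), h1]
  calc mWright β y = (y ^ (-(1 + 1 / β)) * (y ^ (-(1 / β))) ^ (-β - 1)) * mWright β y := by
        rw [h2, one_mul]
    _ = _ := by field_simp

lemma aestronglyMeasurable_mWright {β : ℝ} (hβ0 : 0 < β) (hβ1 : β < 1) :
    AEStronglyMeasurable (mWright β) (volume.restrict (Ioi 0)) := by
  have hL := (continuous_stableDensity hβ0 hβ1).measurable
  have : Measurable fun y : ℝ =>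
      1 / β * y ^ (-(1 + 1 / β)) * stableDensity β (-β) (y ^ (-(1 / β))) := by fun_prop
  refine this.aestronglyMeasurable.congr ((ae_restrict_iff' measurableSet_Ioi).2
    (.of_forall fun y hy => (mWright_eq hβ0 hβ1 hy).symm))

section Nonneg

variable {β : ℝ} (hβ0 : 0 < β) (hβ1 : β < 1) (hL : ∀ x, 0 ≤ stableDensity β (-β) x)

include hβ0 hβ1 hL

lemma mWright_nonneg {y : ℝ} (hy : 0 < y) : 0 ≤ mWright β y := by
  rw [mWright_eq hβ0 hβ1 hy]
  exact mul_nonneg (by positivity) (hL _)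

/-- The moments of negative order of the extremal stable law. -/
lemma stableDensity_neg_moment {a : ℝ} (ha : 0 < a) :
    IntegrableOn (fun x => stableDensity β (-β) x * x ^ (-a)) (Ioi 0) ∧
    ∫ x in Ioi (0 : ℝ), stableDensity β (-β) x * x ^ (-a) =
      Real.Gamma (a / β) / (β * Real.Gamma a) := by
  have hGa := Real.Gamma_pos_of_pos ha
  -- Integrating this nonnegative kernel over `s` first produces `Γ(a) x ^ (-a)`, over `x` first the
  -- known Laplace transform; Fubini equates the two.
  set F : ℝ → ℝ → ℝ := fun s x => s ^ (a - 1) * (Real.exp (-(s * x)) * stableDensity β (-β) x)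
    with hF
  have hLm := (continuous_stableDensity hβ0 hβ1).measurable
  have hFm : AEStronglyMeasurable (Function.uncurry F)
      ((volume.restrict (Ioi (0 : ℝ))).prod (volume.restrict (Ioi (0 : ℝ)))) := by
    refine Measurable.aestronglyMeasurable ?_
    simp only [Function.uncurry_def, hF]
    fun_prop
  have hF0 : ∀ s ∈ Ioi (0 : ℝ), ∀ x, 0 ≤ F s x := fun s hs x =>
    mul_nonneg (Real.rpow_nonneg (le_of_lt hs) _) (mul_nonneg (Real.exp_pos _).le (hL _))
  have hFs : ∀ s ∈ Ioi (0 : ℝ), ∫ x in Ioi (0 : ℝ), F s x = s ^ (a - 1) * Real.exp (-s ^ β) :=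
    fun s hs => by
      simp only [hF]
      rw [integral_const_mul, real_laplace_stableDensity hβ0 hβ1 (le_of_lt hs)]
  have hFi : ∀ s ∈ Ioi (0 : ℝ), IntegrableOn (F s) (Ioi 0) := fun s hs => by
    refine Integrable.const_mul ?_ _
    refine (integrable_stableDensity hβ0 hβ1).integrableOn.mono'
      (Measurable.aestronglyMeasurable (by fun_prop))
      ((ae_restrict_iff' measurableSet_Ioi).2 (.of_forall fun x hx => ?_))
    rw [Real.norm_eq_abs, abs_mul, abs_of_nonneg (hL x), Real.abs_exp]
    refine mul_le_of_le_one_left (hL x) (Real.exp_le_one_iff.2 ?_)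
    have := mul_pos (mem_Ioi.1 hs) (mem_Ioi.1 hx)
    linarith
  have hint : Integrable (Function.uncurry F)
      ((volume.restrict (Ioi (0 : ℝ))).prod (volume.restrict (Ioi (0 : ℝ)))) := by
    refine (integrable_prod_iff hFm).2
      ⟨(ae_restrict_iff' measurableSet_Ioi).2 (.of_forall hFi), ?_⟩
    have h1 := integrableOn_rpow_mul_exp_neg_mul_rpow (s := a - 1) (b := 1) (by linarith) hβ0 one_pos
    refine IntegrableOn.congr_fun h1 (fun s hs => ?_) measurableSet_Ioi
    simp only [Function.uncurry]
    rw [neg_one_mul, ← hFs s hs]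
    refine integral_congr_ae (.of_forall fun x => ?_)
    simp only
    rw [Real.norm_eq_abs, abs_of_nonneg (hF0 s hs x)]
  have hFx : ∀ x ∈ Ioi (0 : ℝ), ∫ s in Ioi (0 : ℝ), F s x =
      Real.Gamma a * (stableDensity β (-β) x * x ^ (-a)) := fun x hx => by
    have hx' : 0 < x := hx
    simp only [hF]
    simp_rw [← mul_assoc, integral_mul_const]
    rw [setIntegral_congr_fun (g := fun s => s ^ (a - 1) * Real.exp (-(x * s))) measurableSet_Ioi
      (fun s _ => by simp only [mul_comm s x]), Real.integral_rpow_mul_exp_neg_mul_Ioi ha hx',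
      one_div, Real.inv_rpow hx'.le, Real.rpow_neg hx'.le]
    ring
  have hI := hint.integral_prod_right
  have hI' : IntegrableOn (fun x => Real.Gamma a * (stableDensity β (-β) x * x ^ (-a))) (Ioi 0) :=
    IntegrableOn.congr_fun hI hFx measurableSet_Ioi
  have hswap := integral_integral_swap hint
  rw [setIntegral_congr_fun measurableSet_Ioi hFs, setIntegral_congr_fun measurableSet_Ioi hFx,
    integral_const_mul, integral_rpow_mul_exp_neg_rpow hβ0 (by linarith), sub_add_cancel] at hswap
  constructor
  · refine IntegrableOn.congr_fun (Integrable.const_mul hI' (Real.Gamma a)⁻¹) (fun x _ => ?_)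
      measurableSet_Ioi
    exact inv_mul_cancel_left₀ hGa.ne' _
  · rw [eq_div_iff (by positivity), mul_comm, mul_assoc, ← hswap]
    field_simp

lemma mWright_moment (n : ℕ) :
    IntegrableOn (fun y => mWright β y * y ^ n) (Ioi 0) ∧
    ∫ y in Ioi (0 : ℝ), mWright β y * y ^ n = n.factorial / Real.Gamma (β * n + 1) := by
  rw [integrableOn_mWright_mul_iff hβ0 hβ1, integral_mWright_mul hβ0 hβ1]
  -- The Gamma integral needs a positive order, so total mass is read off from the Laplace transform
  -- at zero.
  rcases Nat.eq_zero_or_pos n with rfl | hn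
  · have h := real_laplace_stableDensity hβ0 hβ1 le_rfl
    simp only [zero_mul, neg_zero, Real.exp_zero, one_mul, Real.zero_rpow hβ0.ne'] at h
    simpa using ⟨(integrable_stableDensity hβ0 hβ1).integrableOn, h⟩
  · have hn' : (0 : ℝ) < n := by exact_mod_cast hn
    have h := stableDensity_neg_moment hβ0 hβ1 hL (a := β * n) (by positivity)
    have he : EqOn (fun x : ℝ => stableDensity β (-β) x * x ^ (-(β * n)))
        (fun x : ℝ => stableDensity β (-β) x * (x ^ (-β)) ^ n) (Ioi 0) := fun x hx => by
      simp only
      rw [← Real.rpow_natCast, ← Real.rpow_mul (le_of_lt hx), neg_mul]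
    refine ⟨h.1.congr_fun he measurableSet_Ioi, ?_⟩
    rw [← setIntegral_congr_fun measurableSet_Ioi he, h.2, mul_div_cancel_left₀ _ hβ0.ne',
      Real.Gamma_add_one (by positivity)]
    obtain ⟨m, rfl⟩ := Nat.exists_eq_succ_of_ne_zero hn.ne'
    have hG : 0 < Real.Gamma (β * (m + 1 : ℕ)) := Real.Gamma_pos_of_pos (by positivity)
    rw [Nat.succ_eq_add_one, Nat.factorial_succ, Nat.cast_add_one, Real.Gamma_nat_eq_factorial] at *
    field_simp
    push_cast
    ring

end Nonneg

/-! ### The Mittag-Leffler function as an exponential integral of `M` -/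

lemma summable_pow_div_Gamma {β : ℝ} (hβ0 : 0 < β) (hβ1 : β < 1) (c : ℝ) :
    Summable fun n : ℕ => c ^ n / Real.Gamma (β * n + 1) := by
  have ht : Filter.Tendsto (fun n : ℕ => |c| * (2 * (β * n + 1) ^ (-β))) Filter.atTop (nhds 0) := by
    have h1 : Filter.Tendsto (fun n : ℕ => β * (n : ℝ) + 1) Filter.atTop Filter.atTop :=
      Filter.tendsto_atTop_add_const_right _ _
        (tendsto_natCast_atTop_atTop.const_mul_atTop hβ0)
    simpa using (((tendsto_rpow_neg_atTop hβ0).comp h1).const_mul 2).const_mul |c|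
  refine summable_of_ratio_norm_eventually_le (r := 1 / 2) (by norm_num) ?_
  filter_upwards [ht.eventually_le_const (show (0 : ℝ) < 1 / 2 by norm_num)] with n hn
  set a := β * (n : ℝ) + 1 with ha
  have ha1 : 1 ≤ a := by rw [ha]; have : 0 ≤ β * (n : ℝ) := by positivity
                         linarith
  have ha0 : 0 < a := by linarith
  have h1 : β * ((n + 1 : ℕ) : ℝ) + 1 = a + β := by rw [ha]; push_cast; ring
  have hG := Real.Gamma_pos_of_pos ha0
  have hG' := Real.Gamma_pos_of_pos (show 0 < a + β by linarith)
  -- Log-convexity from `a + β` up to `a + 1` bounds `a Γ(a)` by `Γ(a + β)`, giving a ratio of order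
  -- `a ^ (-β)`.
  have hle := Gamma_add_le (a := a + β) (b := 1 - β) (by linarith) (by linarith) (by linarith)
  rw [show a + β + (1 - β) = a + 1 by ring, Real.Gamma_add_one ha0.ne'] at hle
  have h2 : (a + β) ^ (1 - β) ≤ 2 * a ^ (1 - β) := by
    calc (a + β) ^ (1 - β) ≤ (2 * a) ^ (1 - β) :=
          Real.rpow_le_rpow (by linarith) (by linarith) (by linarith)
      _ = 2 ^ (1 - β) * a ^ (1 - β) := Real.mul_rpow (by norm_num) ha0.le
      _ ≤ 2 ^ (1 : ℝ) * a ^ (1 - β) := by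
          gcongr
          · norm_num
          · linarith
      _ = _ := by rw [Real.rpow_one]
  have h3 : a ^ (1 - β) = a * a ^ (-β) := by
    rw [sub_eq_add_neg, Real.rpow_add ha0, Real.rpow_one]
  have h4 : Real.Gamma a ≤ Real.Gamma (a + β) * (2 * a ^ (-β)) := by
    refine le_of_mul_le_mul_left ?_ ha0
    calc a * Real.Gamma a ≤ Real.Gamma (a + β) * (a + β) ^ (1 - β) := hle
      _ ≤ Real.Gamma (a + β) * (2 * a ^ (1 - β)) := by gcongr
      _ = _ := by rw [h3]; ring
  rw [h1, norm_div, norm_div, norm_pow, norm_pow, Real.norm_eq_abs, Real.norm_eq_abs,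
    Real.norm_eq_abs, abs_of_pos hG, abs_of_pos hG', pow_succ, div_le_iff₀ hG']
  have h5 : 0 ≤ |c| ^ n / Real.Gamma a := by positivity
  calc |c| ^ n * |c| = |c| ^ n / Real.Gamma a * |c| * Real.Gamma a := by field_simp
    _ ≤ |c| ^ n / Real.Gamma a * |c| * (Real.Gamma (a + β) * (2 * a ^ (-β))) := by gcongr
    _ = (|c| * (2 * a ^ (-β))) * (|c| ^ n / Real.Gamma a) * Real.Gamma (a + β) := by ring
    _ ≤ _ := by gcongr

section Nonneg

variable {β : ℝ} (hβ0 : 0 < β) (hβ1 : β < 1) (hL : ∀ x, 0 ≤ stableDensity β (-β) x)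

include hβ0 hβ1 hL

/-- Expand the exponential and insert the moments: `n!` cancels. Nonnegativity of `M` turns absolute
summability into convergence of the series at `‖w‖`. -/
lemma integral_exp_mul_mWright (w : ℂ) :
    ∫ y in Ioi (0 : ℝ), Complex.exp (w * y) * (mWright β y : ℂ) = mittagLeffler β w := by
  have key := hasSum_integral_of_summable_integral_norm (μ := volume.restrict (Ioi (0 : ℝ)))
    (F := fun (n : ℕ) (y : ℝ) => w ^ n / n.factorial * ((mWright β y * y ^ n : ℝ) : ℂ))
    (fun n => (mWright_moment hβ0 hβ1 hL n).1.ofReal.const_mul _) ?_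
  · rw [mittagLeffler]
    have h1 : ∀ n : ℕ, ∫ y in Ioi (0 : ℝ), w ^ n / n.factorial * ((mWright β y * y ^ n : ℝ) : ℂ) =
        w ^ n / Complex.Gamma ((β * n + 1 : ℝ) : ℂ) := fun n => by
      rw [integral_const_mul, integral_complex_ofReal, (mWright_moment hβ0 hβ1 hL n).2,
        Complex.Gamma_ofReal]
      have : (n.factorial : ℂ) ≠ 0 := by exact_mod_cast n.factorial_ne_zero
      push_cast
      field_simp
    simp_rw [h1] at key
    rw [key.tsum_eq]
    refine setIntegral_congr_fun measurableSet_Ioi fun y hy => ?_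
    have hs : HasSum (fun n : ℕ => (w * y) ^ n / (n.factorial : ℂ)) (Complex.exp (w * y)) := by
      rw [Complex.exp_eq_exp_ℂ]
      exact NormedSpace.expSeries_div_hasSum_exp _
    rw [← hs.tsum_eq, ← tsum_mul_right]
    refine tsum_congr fun n => ?_
    push_cast
    rw [mul_pow]
    ring
  · refine (summable_pow_div_Gamma hβ0 hβ1 ‖w‖).congr fun n => ?_
    rw [setIntegral_congr_fun (g := fun y : ℝ => ‖w‖ ^ n / n.factorial * (mWright β y * y ^ n))
      measurableSet_Ioi]
    · rw [integral_const_mul, (mWright_moment hβ0 hβ1 hL n).2]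
      have : (n.factorial : ℝ) ≠ 0 := by exact_mod_cast n.factorial_ne_zero
      field_simp
    · intro y hy
      have hy' : 0 < y := hy
      have := mul_nonneg (mWright_nonneg hβ0 hβ1 hL hy') (pow_nonneg hy'.le n)
      simp only
      rw [norm_mul, norm_div, norm_pow, Complex.norm_natCast, Complex.norm_real, Real.norm_eq_abs,
        abs_of_nonneg this]

lemma integrableOn_exp_mul_mWright (w : ℂ) :
    IntegrableOn (fun y : ℝ => Complex.exp (w * y) * (mWright β y : ℂ)) (Ioi 0) := by
  have hm := aestronglyMeasurable_mWright hβ0 hβ1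
  set a := ‖w‖
  have h1 : IntegrableOn (fun y : ℝ => Complex.exp ((a : ℂ) * y) * (mWright β y : ℂ)) (Ioi 0) := by
    -- A non-integrable function has integral `0` by convention, but at the nonnegative point `‖w‖`
    -- the integral equals a series with positive sum.
    by_contra h
    have h2 := integral_exp_mul_mWright hβ0 hβ1 hL a
    rw [integral_undef h] at h2
    have h3 : mittagLeffler β (a : ℂ) = ((∑' n : ℕ, a ^ n / Real.Gamma (β * n + 1) : ℝ) : ℂ) := by
      rw [mittagLeffler, Complex.ofReal_tsum]
      refine tsum_congr fun n => ?_
      rw [Complex.Gamma_ofReal]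
      push_cast
      rfl
    rw [h3] at h2
    have h4 : 0 < ∑' n : ℕ, a ^ n / Real.Gamma (β * n + 1) := by
      refine (summable_pow_div_Gamma hβ0 hβ1 a).tsum_pos (fun n => ?_) 0 (by simp)
      exact div_nonneg (pow_nonneg (norm_nonneg _) _) (Real.Gamma_pos_of_pos (by positivity)).le
    exact h4.ne (by exact_mod_cast h2)
  refine h1.norm.mono' ((Continuous.aestronglyMeasurable (by fun_prop)).mul
    (Complex.continuous_ofReal.comp_aestronglyMeasurable hm))
    ((ae_restrict_iff' measurableSet_Ioi).2 (.of_forall fun y hy => ?_))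
  rw [norm_mul, norm_mul, Complex.norm_exp, Complex.norm_exp]
  refine mul_le_mul_of_nonneg_right (Real.exp_le_exp.2 ?_) (norm_nonneg _)
  have : w.re * y ≤ a * y := mul_le_mul_of_nonneg_right (Complex.re_le_norm w) (le_of_lt hy)
  simpa using this

lemma hasDerivAt_mittagLeffler (w : ℂ) :
    IntegrableOn (fun y : ℝ => (y : ℂ) * (Complex.exp (w * y) * (mWright β y : ℂ))) (Ioi 0) ∧
    HasDerivAt (mittagLeffler β)
      (∫ y in Ioi (0 : ℝ), (y : ℂ) * (Complex.exp (w * y) * (mWright β y : ℂ))) w := by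
  -- Shifting to `w + 1` and differentiating at `s = 1` keeps the Laplace variable in the open
  -- half-plane for every complex `w`.
  have h := hasDerivAt_laplace (integrableOn_exp_mul_mWright hβ0 hβ1 hL (w + 1)) (s := 1) (by simp)
  have he : ∀ (z : ℂ) (y : ℝ), Complex.exp (-(z * y)) * (Complex.exp ((w + 1) * y) *
      (mWright β y : ℂ)) = Complex.exp ((w + 1 - z) * y) * (mWright β y : ℂ) := fun z y => by
    rw [← mul_assoc, ← Complex.exp_add]
    ring_nf
  simp_rw [he, integral_exp_mul_mWright hβ0 hβ1 hL, add_sub_cancel_right] at h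
  refine ⟨?_, ?_⟩
  · simpa using h.1.neg
  · have h2 : HasDerivAt (fun z : ℂ => w + 1 - z) (-1) w := by
      simpa using (hasDerivAt_id w).const_sub (w + 1)
    have h4 := HasDerivAt.comp_of_eq w h.2 h2 (add_sub_cancel_left w 1).symm
    simp only [Function.comp_def, sub_sub_cancel] at h4
    refine h4.congr_deriv ?_
    rw [mul_neg_one, ← integral_neg]
    simp

end Nonneg

lemma tendsto_integral_exp_neg_mul {f : ℝ → ℂ} (hf : IntegrableOn f (Ioi 0)) {p : ℂ}
    (hp : 0 < p.re) :
    Filter.Tendsto (fun z : ℝ => ∫ y in Ioi (0 : ℝ), Complex.exp (-(p * z * y)) * f y)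
      Filter.atTop (nhds 0) := by
  have h := tendsto_integral_filter_of_dominated_convergence (μ := volume.restrict (Ioi (0 : ℝ)))
    (F := fun (z y : ℝ) => Complex.exp (-(p * z * y)) * f y) (f := fun _ => 0)
    (l := Filter.atTop) (fun y => ‖f y‖) ?_ ?_ hf.norm ?_
  · simpa using h
  · exact .of_forall fun z => (Continuous.aestronglyMeasurable (by fun_prop)).mul hf.aestronglyMeasurable
  · filter_upwards [Filter.eventually_ge_atTop 0] with z hz
    refine (ae_restrict_iff' measurableSet_Ioi).2 (.of_forall fun y hy => ?_)
    rw [norm_mul]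
    exact mul_le_of_le_one_left (norm_nonneg _) (norm_exp_neg_mul_le_one
      (by simpa using mul_nonneg hp.le hz) (le_of_lt hy))
  · refine (ae_restrict_iff' measurableSet_Ioi).2 (.of_forall fun y hy => ?_)
    have hy' : 0 < y := hy
    have h1 : Filter.Tendsto (fun z : ℝ => Complex.exp (-(p * z * y))) Filter.atTop (nhds 0) := by
      rw [tendsto_zero_iff_norm_tendsto_zero]
      simp_rw [Complex.norm_exp]
      have h2 : ∀ z : ℝ, (-(p * z * y)).re = -(p.re * y * z) := fun z => by
        simp
        ring
      simp_rw [h2]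
      exact Real.tendsto_exp_neg_atTop_nhds_zero.comp
        (Filter.tendsto_id.const_mul_atTop (mul_pos hp hy'))
    simpa using h1.mul_const (f y)

lemma continuous_deriv_of_differentiable {f : ℂ → ℂ} (hf : Differentiable ℂ f) :
    Continuous (deriv f) :=
  (hf.contDiff (n := 1)).continuous_deriv le_rfl

/-! ### The densities as functions of `τ`: normalization and Laplace transforms -/

section Nonneg

variable {β : ℝ} (hβ0 : 0 < β) (hβ1 : β < 1) (hL : ∀ x, 0 ≤ stableDensity β (-β) x)

include hβ0 hβ1 hL

omit hβ0 hβ1 in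
lemma rDensity_nonneg {t τ : ℝ} (hτ : 0 < τ) : 0 ≤ rDensity β t τ := by
  rw [rDensity_eq hτ]
  exact mul_nonneg (by positivity) (hL _)

lemma qDensity_nonneg {t τ : ℝ} (ht : 0 < t) (hτ : 0 < τ) : 0 ≤ qDensity β τ t :=
  mul_nonneg (by positivity) (mWright_nonneg hβ0 hβ1 hL (by positivity))

lemma integrableOn_mWright : IntegrableOn (mWright β) (Ioi 0) := by
  simpa using (mWright_moment hβ0 hβ1 hL 0).1

lemma integral_mWright : ∫ y in Ioi (0 : ℝ), mWright β y = 1 := by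
  simpa using (mWright_moment hβ0 hβ1 hL 0).2

omit hβ0 hβ1 hL in
lemma qDensity_eq_scale {t : ℝ} (ht : 0 < t) (τ : ℝ) :
    qDensity β τ t = t ^ (-β) * mWright β (t ^ (-β) * τ) := by
  rw [qDensity, Real.rpow_neg ht.le, div_eq_inv_mul]

lemma integrableOn_qDensity {t : ℝ} (ht : 0 < t) : IntegrableOn (fun τ => qDensity β τ t) (Ioi 0) := by
  simp_rw [qDensity_eq_scale ht]
  exact integrableOn_Ioi_scale (by positivity) (integrableOn_mWright hβ0 hβ1 hL)

lemma integral_qDensity {t : ℝ} (ht : 0 < t) : ∫ τ in Ioi (0 : ℝ), qDensity β τ t = 1 := by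
  simp_rw [qDensity_eq_scale ht]
  rw [← integral_mWright hβ0 hβ1 hL]
  exact integral_Ioi_scale (mWright β) (by positivity)

omit hL in
/-- The distribution function of `q_β` is the tail of `r_β`. -/
lemma integral_qDensity_eq_tail {t τ : ℝ} (ht : 0 < t) (hτ : 0 < τ) :
    ∫ τ' in (0 : ℝ)..τ, qDensity β τ' t = ∫ t' in Ioi t, rDensity β t' τ := by
  have hb : 0 < t ^ (-β) := by positivity
  have hc : 0 < (τ ^ (1 / β))⁻¹ := by positivity
  -- After scaling, both sides are integrals of this one indicator, against `M` and against `L`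
  -- through `y = x ^ (-β)`; the negative exponent turns an upper bound on `y` into a lower bound on
  -- `x`.
  set g : ℝ → ℝ := (Iic (t ^ (-β) * τ)).indicator 1 with hg
  have h1 : ∫ τ' in (0 : ℝ)..τ, qDensity β τ' t = ∫ y in Ioi (0 : ℝ), mWright β y * g y := by
    rw [← integral_Ioi_scale _ hb, intervalIntegral.integral_of_le hτ.le, ← Ioi_inter_Iic,
      inter_comm, ← Measure.restrict_restrict measurableSet_Iic, ← integral_indicator measurableSet_Iic]
    congr 1 with τ'
    by_cases h : τ' ≤ τ
    · rw [indicator_of_mem (mem_Iic.2 h), hg, indicator_of_mem (mem_Iic.2 (by gcongr)),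
        qDensity_eq_scale ht]
      simp
    · rw [indicator_of_notMem (by simpa using h), hg, indicator_of_notMem, mul_zero, smul_zero]
      rw [mem_Iic, mul_le_mul_iff_right₀ hb]
      exact h
  have h2 : ∫ t' in Ioi t, rDensity β t' τ =
      ∫ x in Ioi (0 : ℝ), stableDensity β (-β) x * g (x ^ (-β)) := by
    rw [← integral_Ioi_scale _ hc, ← integral_Ici_eq_integral_Ioi, ← integral_indicator measurableSet_Ici,
      ← integral_indicator measurableSet_Ioi]
    congr 1 with x
    by_cases hx0 : 0 < x
    · rw [indicator_of_mem (mem_Ioi.2 hx0)]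
      have hiff : ((τ ^ (1 / β))⁻¹ * x) ^ (-β) ≤ t ^ (-β) * τ ↔ t ≤ x := by
        have h3 : ((τ ^ (1 / β))⁻¹ * x) ^ (-β) = x ^ (-β) * τ := by
          rw [Real.mul_rpow hc.le hx0.le, Real.inv_rpow (by positivity), ← Real.rpow_neg (by positivity),
            neg_neg, ← Real.rpow_mul hτ.le, one_div_mul_cancel hβ0.ne', Real.rpow_one, mul_comm]
        rw [h3, mul_le_mul_iff_left₀ hτ, Real.rpow_le_rpow_iff_of_neg hx0 ht (by linarith)]
      by_cases h : t ≤ x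
      · rw [indicator_of_mem (mem_Ici.2 h), hg, indicator_of_mem (mem_Iic.2 (hiff.2 h)),
          rDensity_eq hτ]
        simp
      · rw [indicator_of_notMem (by simpa using h), hg, indicator_of_notMem, mul_zero, smul_zero]
        rwa [mem_Iic, hiff]
    · rw [indicator_of_notMem (show x ∉ Ioi 0 from hx0), indicator_of_notMem]
      exact fun h => hx0 (ht.trans_le h)
  rw [h1, h2, integral_mWright_mul hβ0 hβ1]

lemma hasLaplaceAt_qDensity_operational {t : ℝ} (ht : 0 < t) (p : ℂ) :
    HasLaplaceAt (fun τ => (qDensity β τ t : ℂ)) p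
      (mittagLeffler β (-(p * ((t ^ β : ℝ) : ℂ)))) := by
  have hb : 0 < t ^ (-β) := by positivity
  have hbb : (((t ^ β : ℝ) : ℂ)) * (((t ^ (-β) : ℝ) : ℂ)) = 1 := by
    rw [← Complex.ofReal_mul, ← Real.rpow_add ht, add_neg_cancel, Real.rpow_zero, Complex.ofReal_one]
  have he : ∀ τ : ℝ, t ^ (-β) • (Complex.exp (-(p * ((t ^ β : ℝ) : ℂ)) * ((t ^ (-β) * τ : ℝ) : ℂ)) *
      (mWright β (t ^ (-β) * τ) : ℂ)) = Complex.exp (-(p * τ)) * (qDensity β τ t : ℂ) := fun τ => by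
    rw [qDensity_eq_scale ht, Complex.real_smul]
    have : -(p * ((t ^ β : ℝ) : ℂ)) * ((t ^ (-β) * τ : ℝ) : ℂ) = -(p * τ) := by
      rw [Complex.ofReal_mul]
      linear_combination (-(p * τ)) * hbb
    rw [this]
    push_cast
    ring
  have h1 := integrableOn_Ioi_scale hb
    (integrableOn_exp_mul_mWright hβ0 hβ1 hL (-(p * ((t ^ β : ℝ) : ℂ))))
  have h2 := integral_Ioi_scale (fun y : ℝ =>
    Complex.exp (-(p * ((t ^ β : ℝ) : ℂ)) * y) * (mWright β y : ℂ)) hb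
  simp_rw [he] at h1 h2
  rw [integral_exp_mul_mWright hβ0 hβ1 hL] at h2
  exact ⟨h1, h2⟩

lemma hasLaplaceAt_rDensity_operational {t : ℝ} (ht : 0 < t) (p : ℂ) :
    HasLaplaceAt (fun τ => (rDensity β t τ : ℂ)) p
      (((β * t ^ (β - 1) : ℝ) : ℂ) *
        deriv (mittagLeffler β) (-(p * ((t ^ β : ℝ) : ℂ)))) := by
  have hb : 0 < t ^ (-β) := by positivity
  have hbb : (((t ^ β : ℝ) : ℂ)) * (((t ^ (-β) : ℝ) : ℂ)) = 1 := by
    rw [← Complex.ofReal_mul, ← Real.rpow_add ht, add_neg_cancel, Real.rpow_zero, Complex.ofReal_one]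
  obtain ⟨hi, hd⟩ := hasDerivAt_mittagLeffler hβ0 hβ1 hL (-(p * ((t ^ β : ℝ) : ℂ)))
  have he : EqOn (fun τ : ℝ => t ^ (-β) • (((β * t ^ (β - 1) : ℝ) : ℂ) * (((t ^ (-β) * τ : ℝ) : ℂ) *
      (Complex.exp (-(p * ((t ^ β : ℝ) : ℂ)) * ((t ^ (-β) * τ : ℝ) : ℂ)) *
      (mWright β (t ^ (-β) * τ) : ℂ)))))
      (fun τ : ℝ => Complex.exp (-(p * τ)) * (rDensity β t τ : ℂ)) (Ioi 0) := fun τ hτ => by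
    have : -(p * ((t ^ β : ℝ) : ℂ)) * ((t ^ (-β) * τ : ℝ) : ℂ) = -(p * τ) := by
      rw [Complex.ofReal_mul]
      linear_combination (-(p * τ)) * hbb
    simp only
    rw [this, rDensity_eq_qDensity hβ0 hβ1 ht hτ, qDensity_eq_scale ht, Complex.real_smul]
    have h3 : t ^ (β - 1) = t ^ β / t := Real.rpow_sub_one ht.ne' _
    rw [h3]
    push_cast
    linear_combination (Complex.exp (-(p * τ)) * β * τ / t * ((t ^ (-β) : ℝ) : ℂ) *
      (mWright β (t ^ (-β) * τ) : ℂ)) * hbb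
  have h1 := integrableOn_Ioi_scale hb
    (Integrable.const_mul hi ((β * t ^ (β - 1) : ℝ) : ℂ))
  have h2 := integral_Ioi_scale (fun y : ℝ => ((β * t ^ (β - 1) : ℝ) : ℂ) * ((y : ℂ) *
    (Complex.exp (-(p * ((t ^ β : ℝ) : ℂ)) * y) * (mWright β y : ℂ)))) hb
  rw [integral_const_mul, ← hd.deriv, setIntegral_congr_fun measurableSet_Ioi he] at h2
  exact ⟨h1.congr_fun he measurableSet_Ioi, h2⟩

lemma differentiable_mittagLeffler : Differentiable ℂ (mittagLeffler β) := fun w =>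
  (hasDerivAt_mittagLeffler hβ0 hβ1 hL w).2.differentiableAt

lemma tendsto_mittagLeffler_neg {p : ℂ} (hp : 0 < p.re) :
    Filter.Tendsto (fun x : ℝ => mittagLeffler β (-(p * ((x ^ β : ℝ) : ℂ)))) Filter.atTop (nhds 0) := by
  have h := (tendsto_integral_exp_neg_mul (integrableOn_mWright hβ0 hβ1 hL).ofReal hp).comp
    (tendsto_rpow_atTop hβ0)
  refine h.congr fun x => ?_
  simp only [Function.comp]
  rw [← integral_exp_mul_mWright hβ0 hβ1 hL]
  simp only [neg_mul]
  rfl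

lemma hasDerivAt_mittagLeffler_comp (p : ℂ) {x : ℝ} (hx : 0 < x) :
    HasDerivAt (fun x : ℝ => -mittagLeffler β (-(p * ((x ^ β : ℝ) : ℂ))))
      (p * ((β * x ^ (β - 1) : ℝ) : ℂ) * deriv (mittagLeffler β) (-(p * ((x ^ β : ℝ) : ℂ)))) x := by
  have h1 : HasDerivAt (fun x : ℝ => ((x ^ β : ℝ) : ℂ)) ((β * x ^ (β - 1) : ℝ) : ℂ) x :=
    (Real.hasDerivAt_rpow_const (Or.inl hx.ne')).ofReal_comp
  have h2 := (differentiable_mittagLeffler hβ0 hβ1 hL (-(p * ((x ^ β : ℝ) : ℂ)))).hasDerivAt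
  have h3 := (h2.scomp x (h1.const_mul p).neg).neg
  refine h3.congr_deriv ?_
  rw [smul_eq_mul]
  ring

/-- The derivative is the integral of `y exp (w y)` against the nonnegative weight `M`, so the
triangle inequality leaves only the real part of `w`. -/
lemma norm_deriv_mittagLeffler_le (w : ℂ) :
    ‖deriv (mittagLeffler β) w‖ ≤ (deriv (mittagLeffler β) (w.re : ℂ)).re := by
  rw [(hasDerivAt_mittagLeffler hβ0 hβ1 hL w).2.deriv,
    (hasDerivAt_mittagLeffler hβ0 hβ1 hL w.re).2.deriv]
  have he : ∀ y ∈ Ioi (0 : ℝ), ((y : ℂ) * (Complex.exp (w.re * y) * (mWright β y : ℂ))) =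
      ((‖(y : ℂ) * (Complex.exp (w * y) * (mWright β y : ℂ))‖ : ℝ) : ℂ) := fun y hy => by
    rw [norm_mul, norm_mul, Complex.norm_exp, Complex.norm_real, Complex.norm_real,
      Real.norm_eq_abs, Real.norm_eq_abs, abs_of_pos hy, abs_of_nonneg (mWright_nonneg hβ0 hβ1 hL hy),
      Complex.re_mul_ofReal]
    push_cast
    rfl
  rw [setIntegral_congr_fun measurableSet_Ioi he, integral_complex_ofReal, Complex.ofReal_re]
  exact norm_integral_le_integral_norm _

lemma integral_deriv_mittagLeffler {t : ℝ} (ht : 0 < t) {p : ℂ} (hp : 0 < p.re) :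
    IntegrableOn (fun x : ℝ => p * ((β * x ^ (β - 1) : ℝ) : ℂ) *
        deriv (mittagLeffler β) (-(p * ((x ^ β : ℝ) : ℂ)))) (Ioi t) ∧
      ∫ x in Ioi t, p * ((β * x ^ (β - 1) : ℝ) : ℂ) *
          deriv (mittagLeffler β) (-(p * ((x ^ β : ℝ) : ℂ))) =
        mittagLeffler β (-(p * ((t ^ β : ℝ) : ℂ))) := by
  have hdc := continuous_deriv_of_differentiable (differentiable_mittagLeffler hβ0 hβ1 hL)
  have hd : ∀ (p : ℂ), ∀ x ∈ Ici t, _ := fun p x hx =>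
    hasDerivAt_mittagLeffler_comp hβ0 hβ1 hL p (ht.trans_le hx)
  have hnn : ∀ a : ℝ, 0 ≤ (deriv (mittagLeffler β) (a : ℂ)).re := fun a =>
    (norm_nonneg _).trans (by simpa using norm_deriv_mittagLeffler_le hβ0 hβ1 hL (a : ℂ))
  -- At the real point `Re p` the integrand is nonnegative and its primitive has a limit, which
  -- gives integrability; the complex case is dominated by this one times `‖p‖ / Re p`.
  have hreal : IntegrableOn (fun x : ℝ => p.re * (β * x ^ (β - 1)) *
      (deriv (mittagLeffler β) ((-(p.re * x ^ β) : ℝ) : ℂ)).re) (Ioi t) := by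
    have hgd : ∀ x ∈ Ici t, HasDerivAt (fun x : ℝ => (-mittagLeffler β (-((p.re : ℂ) * ((x ^ β : ℝ) : ℂ)))).re)
        (p.re * (β * x ^ (β - 1)) * (deriv (mittagLeffler β) ((-(p.re * x ^ β) : ℝ) : ℂ)).re) x := by
      intro x hx
      have h := Complex.reCLM.hasFDerivAt.comp_hasDerivAt x (hd p.re x hx)
      refine h.congr_deriv ?_
      rw [Complex.reCLM_apply, ← Complex.ofReal_mul, Complex.re_ofReal_mul]
      push_cast
      rfl
    refine integrableOn_Ioi_deriv_of_nonneg' (l := 0) hgd (fun x hx => ?_) ?_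
    · have hx0 : 0 < x := ht.trans hx
      exact mul_nonneg (by positivity) (hnn _)
    · have h := (tendsto_mittagLeffler_neg hβ0 hβ1 hL (p := (p.re : ℂ)) (by simpa using hp)).neg
      simpa [Function.comp_def] using (Complex.continuous_re.tendsto _).comp h
  have hint : IntegrableOn (fun x : ℝ => p * ((β * x ^ (β - 1) : ℝ) : ℂ) *
      deriv (mittagLeffler β) (-(p * ((x ^ β : ℝ) : ℂ)))) (Ioi t) := by
    refine Integrable.mono' (Integrable.const_mul hreal (‖p‖ / p.re)) ?_
      ((ae_restrict_iff' measurableSet_Ioi).2 (.of_forall fun x hx => ?_))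
    · refine (Measurable.mul (by fun_prop) (hdc.measurable.comp (by fun_prop))).aestronglyMeasurable
    · have hx0 : 0 < x := ht.trans hx
      have hk : 0 < β * x ^ (β - 1) := by positivity
      have h := norm_deriv_mittagLeffler_le hβ0 hβ1 hL (-(p * ((x ^ β : ℝ) : ℂ)))
      rw [Complex.neg_re, Complex.re_mul_ofReal] at h
      rw [norm_mul, norm_mul, Complex.norm_real, Real.norm_eq_abs, abs_of_pos hk]
      calc _ ≤ ‖p‖ * (β * x ^ (β - 1)) * (deriv (mittagLeffler β) ((-(p.re * x ^ β) : ℝ) : ℂ)).re := by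
            gcongr
        _ = _ := by field_simp
  refine ⟨hint, ?_⟩
  rw [integral_Ioi_of_hasDerivAt_of_tendsto' (hd p) hint
    (by simpa using (tendsto_mittagLeffler_neg hβ0 hβ1 hL hp).neg)]
  ring

end Nonneg

/-! ### Double Laplace transforms -/

section DoubleLaplace

variable {β : ℝ} (hβ0 : 0 < β) (hβ1 : β < 1)

include hβ0 hβ1

lemma hasDoubleLaplaceAt_of_hasLaplaceAt {f : ℝ → ℝ → ℝ} {A : ℂ → ℂ} {p s : ℂ}
    (hp : 0 ≤ p.re) (hs : 0 < s.re)
    (hfm : AEStronglyMeasurable (Function.uncurry f)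
      ((volume.restrict (Ioi (0 : ℝ))).prod (volume.restrict (Ioi (0 : ℝ)))))
    (hf0 : ∀ τ ∈ Ioi (0 : ℝ), ∀ t ∈ Ioi (0 : ℝ), 0 ≤ f τ t)
    (hf : ∀ τ ∈ Ioi (0 : ℝ), ∀ s : ℂ, 0 < s.re →
      HasLaplaceAt (fun t => (f τ t : ℂ)) s (A s * Complex.exp (-(τ * s ^ (β : ℂ))))) :
    HasDoubleLaplaceAt (fun τ t => (f τ t : ℂ)) p s (A s / (p + s ^ (β : ℂ))) := by
  have hs0 : s ≠ 0 := by rintro rfl; simp at hs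
  have hsβ := re_cpow_pos hβ0 hβ1 hs.le hs0
  have hk : (-(p + s ^ (β : ℂ))).re < 0 := by
    rw [Complex.neg_re, Complex.add_re]; linarith
  have hk' : (-(p + (s.re : ℂ) ^ (β : ℂ))).re < 0 := by
    have := re_cpow_pos hβ0 hβ1 (s := (s.re : ℂ)) (by simpa using hs.le)
      (by exact_mod_cast hs.ne')
    rw [Complex.neg_re, Complex.add_re]; linarith
  have hint : Integrable (fun x : ℝ × ℝ =>
      Complex.exp (-(p * x.1)) * Complex.exp (-(s * x.2)) * (f x.1 x.2 : ℂ))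
      ((volume.restrict (Ioi (0 : ℝ))).prod (volume.restrict (Ioi (0 : ℝ)))) := by
    refine (integrable_prod_iff ?_).2 ⟨?_, ?_⟩
    · exact (Continuous.aestronglyMeasurable (by fun_prop)).mul
        (Complex.continuous_ofReal.comp_aestronglyMeasurable hfm)
    · refine (ae_restrict_iff' measurableSet_Ioi).2 (.of_forall fun τ hτ => ?_)
      simp_rw [mul_assoc]
      exact (hf τ hτ s hs).1.const_mul _
    -- As `f ≥ 0`, the inner integral of norms is again a Laplace transform, at `Re s`; its decay in
    -- `τ` comes from `(Re s) ^ β > 0`, so `Re p = 0` is allowed.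
    · refine IntegrableOn.congr_fun (Integrable.norm (Integrable.const_mul
        (integrableOn_exp_mul_complex_Ioi hk' 0) (A (s.re : ℂ)))) (fun τ hτ => ?_) measurableSet_Ioi
      have h1 := hf τ hτ (s.re : ℂ) (by simpa using hs)
      have h2 : ∫ t in Ioi (0 : ℝ), ‖Complex.exp (-(p * τ)) * Complex.exp (-(s * t)) * (f τ t : ℂ)‖ =
          ‖Complex.exp (-(p * τ))‖ * ∫ t in Ioi (0 : ℝ), Real.exp (-(s.re * t)) * f τ t := by
        rw [← integral_const_mul]
        refine setIntegral_congr_fun measurableSet_Ioi fun t ht => ?_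
        rw [norm_mul, norm_mul, Complex.norm_real, Real.norm_eq_abs, abs_of_nonneg (hf0 τ hτ t ht),
          Complex.norm_exp (-(s * t)), Complex.neg_re, Complex.re_mul_ofReal, mul_assoc]
      have h3 : ((∫ t in Ioi (0 : ℝ), Real.exp (-(s.re * t)) * f τ t : ℝ) : ℂ) =
          A (s.re : ℂ) * Complex.exp (-(τ * (s.re : ℂ) ^ (β : ℂ))) := by
        rw [← h1.2, ← integral_complex_ofReal]
        push_cast
        rfl
      have h4 : 0 ≤ ∫ t in Ioi (0 : ℝ), Real.exp (-(s.re * t)) * f τ t :=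
        setIntegral_nonneg measurableSet_Ioi fun t ht =>
          mul_nonneg (Real.exp_pos _).le (hf0 τ hτ t ht)
      simp only
      rw [h2, ← abs_of_nonneg h4, ← Real.norm_eq_abs, ← Complex.norm_real, h3, ← norm_mul]
      congr 1
      rw [mul_left_comm, ← Complex.exp_add]
      ring_nf
  have hint' := hint
  rw [Measure.prod_restrict] at hint'
  refine ⟨hint', ?_⟩
  rw [Measure.volume_eq_prod, ← Measure.prod_restrict, integral_prod _ hint]
  have h5 : ∀ τ ∈ Ioi (0 : ℝ), ∫ t in Ioi (0 : ℝ),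
      Complex.exp (-(p * τ)) * Complex.exp (-(s * t)) * (f τ t : ℂ) =
      A s * Complex.exp (-(p + s ^ (β : ℂ)) * τ) := fun τ hτ => by
    simp_rw [mul_assoc]
    rw [integral_const_mul, (hf τ hτ s hs).2, mul_left_comm, ← Complex.exp_add]
    ring_nf
  rw [setIntegral_congr_fun measurableSet_Ioi h5, integral_const_mul,
    integral_exp_mul_complex_Ioi hk]
  rw [Complex.ofReal_zero, mul_zero, Complex.exp_zero, neg_div_neg_eq, mul_one_div]

lemma measurable_rDensity : Measurable (Function.uncurry fun τ t => rDensity β t τ) := by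
  have hL := (continuous_stableDensity hβ0 hβ1).measurable
  simp only [Function.uncurry_def, rDensity]
  fun_prop

lemma hasDoubleLaplaceAt_rDensity (hL : ∀ x, 0 ≤ stableDensity β (-β) x) {p s : ℂ}
    (hp : 0 ≤ p.re) (hs : 0 < s.re) :
    HasDoubleLaplaceAt (fun τ t => (rDensity β t τ : ℂ)) p s (1 / (p + s ^ (β : ℂ))) := by
  refine hasDoubleLaplaceAt_of_hasLaplaceAt (A := fun _ => 1) hβ0 hβ1 hp hs
    (measurable_rDensity hβ0 hβ1).aestronglyMeasurable
    (fun τ hτ t _ => rDensity_nonneg hL hτ) (fun τ hτ s hs => ?_)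
  rw [one_mul]
  exact hasLaplaceAt_rDensity hβ0 hβ1 hτ hs.le

lemma hasDoubleLaplaceAt_qDensity (hL : ∀ x, 0 ≤ stableDensity β (-β) x) {p s : ℂ}
    (hp : 0 ≤ p.re) (hs : 0 < s.re) :
    HasDoubleLaplaceAt (fun τ t => (qDensity β τ t : ℂ)) p s
      (s ^ ((β : ℂ) - 1) / (p + s ^ (β : ℂ))) := by
  refine hasDoubleLaplaceAt_of_hasLaplaceAt (A := fun s => s ^ ((β : ℂ) - 1)) hβ0 hβ1 hp hs ?_
    (fun τ hτ t ht => qDensity_nonneg hβ0 hβ1 hL ht hτ)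
    (fun τ hτ s hs => hasLaplaceAt_qDensity hβ0 hβ1 hτ hs)
  have h : Measurable fun x : ℝ × ℝ => x.2 / (β * x.1) *
    Function.uncurry (fun τ t => rDensity β t τ) x :=
    Measurable.mul (by fun_prop) (measurable_rDensity hβ0 hβ1)
  refine h.aestronglyMeasurable.congr ?_
  rw [Measure.prod_restrict]
  refine (ae_restrict_iff' (measurableSet_Ioi.prod measurableSet_Ioi)).2 (.of_forall ?_)
  rintro ⟨τ, t⟩ ⟨hτ, ht⟩
  exact (qDensity_eq_rDensity hβ0 hβ1 ht hτ).symm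

end DoubleLaplace

/-! ### Uniqueness of Laplace transforms and the fractional integral -/

/-- Uniqueness of Laplace transforms, pointwise at continuity points. -/
lemma eq_zero_of_laplace_eq_zero {f : ℝ → ℂ} (hf : IntegrableOn f (Ioi 0))
    (h : ∀ s : ℝ, 0 < s → ∫ x in Ioi (0 : ℝ), Complex.exp (-(s * x)) * f x = 0) {v : ℝ} (hv : 0 < v)
    (hc : ContinuousAt f v) : f v = 0 := by
  set F : ℂ → ℂ := fun z => ∫ x in Ioi (0 : ℝ), Complex.exp (-(z * x)) * f x with hF
  have hopen : IsOpen {z : ℂ | 0 < z.re} := isOpen_lt continuous_const Complex.continuous_re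
  have hconn : IsPreconnected {z : ℂ | 0 < z.re} := (convex_halfSpace_re_gt 0).isPreconnected
  have hA : AnalyticOnNhd ℂ F {z : ℂ | 0 < z.re} := DifferentiableOn.analyticOnNhd
    (fun z hz => (hasDerivAt_laplace hf hz).2.differentiableAt.differentiableWithinAt) hopen
  -- Real zeros accumulating at `1` suffice for the identity theorem on the half-plane.
  have hseq : Filter.Tendsto (fun n : ℕ => ((1 + 1 / ((n : ℝ) + 1) : ℝ) : ℂ)) Filter.atTop
      (nhdsWithin 1 {1}ᶜ) := by
    refine tendsto_nhdsWithin_iff.2 ⟨?_, .of_forall fun n => ?_⟩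
    · have h1 : Filter.Tendsto (fun n : ℕ => (1 + 1 / ((n : ℝ) + 1) : ℝ)) Filter.atTop (nhds 1) := by
        simpa using tendsto_one_div_add_atTop_nhds_zero_nat.const_add (1 : ℝ)
      exact_mod_cast (Complex.continuous_ofReal.tendsto 1).comp h1
    · have h2 : (1 : ℝ) < 1 + 1 / ((n : ℝ) + 1) := by
        have : 0 < 1 / ((n : ℝ) + 1) := by positivity
        linarith
      rw [mem_compl_singleton_iff]
      exact_mod_cast h2.ne'
  have hfreq : ∃ᶠ z in nhdsWithin (1 : ℂ) {1}ᶜ, F z = 0 :=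
    hseq.frequently (Filter.Frequently.of_forall fun n => h _ (by positivity))
  have hzero := hA.eqOn_zero_of_preconnected_of_frequently_eq_zero hconn (z₀ := 1)
    (by simp) hfreq
  set g : ℝ → ℂ := (Ioi (0 : ℝ)).indicator fun x : ℝ => Complex.exp (-((1 : ℂ) * x)) * f x with hg
  have hgi : Integrable g := (integrable_indicator_iff measurableSet_Ioi).2
    (integrableOn_exp_neg_mul hf (s := 1) (by simp))
  have hgF : FourierTransform.fourier g = 0 := by
    ext w
    rw [Real.fourier_real_eq_integral_exp_smul]
    -- On the line `Re z = 1` the transform is the Fourier transform of `exp (-x) f x`, to which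
    -- inversion applies.
    have hz := hzero (x := 1 + 2 * Real.pi * w * Complex.I) (by simp)
    rw [Pi.zero_apply] at hz
    rw [Pi.zero_apply, ← hz]
    simp only [hF]
    rw [← integral_indicator measurableSet_Ioi]
    congr 1 with x
    rw [hg]
    by_cases hx : x ∈ Ioi (0 : ℝ)
    · rw [indicator_of_mem hx, indicator_of_mem hx, smul_eq_mul, ← mul_assoc, ← Complex.exp_add]
      congr 2
      push_cast
      ring
    · rw [indicator_of_notMem hx, indicator_of_notMem hx, smul_zero]
  have hgc : ContinuousAt g v := by
    have h1 : ContinuousAt (fun x : ℝ => Complex.exp (-((1 : ℂ) * x)) * f x) v :=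
      ContinuousAt.mul (by fun_prop) hc
    refine h1.congr ?_
    filter_upwards [Ioi_mem_nhds hv] with x hx
    rw [hg, indicator_of_mem hx]
  have hinv := hgi.fourierInv_fourier_eq (by rw [hgF]; exact integrable_zero _ _ _) hgc
  rw [hgF, Real.fourierInv_eq'] at hinv
  simp only [Pi.zero_apply, smul_zero, integral_zero] at hinv
  rw [hg, indicator_of_mem (mem_Ioi.2 hv)] at hinv
  exact (mul_eq_zero.1 hinv.symm).resolve_left (Complex.exp_ne_zero _)

lemma HasLaplaceAt.ofReal {f : ℝ → ℝ} {s F : ℝ} (h : HasLaplaceAt (fun x => (f x : ℂ)) s F) :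
    IntegrableOn (fun x => Real.exp (-(s * x)) * f x) (Ioi 0) ∧
      ∫ x in Ioi (0 : ℝ), Real.exp (-(s * x)) * f x = F := by
  have he : ∀ x : ℝ, Complex.exp (-((s : ℂ) * x)) * (f x : ℂ) =
      ((Real.exp (-(s * x)) * f x : ℝ) : ℂ) := fun x => by push_cast; rfl
  obtain ⟨h1, h2⟩ := h
  simp_rw [he] at h1 h2
  rw [integral_complex_ofReal] at h2
  exact ⟨h1.re, by exact_mod_cast h2⟩

lemma intervalIntegrable_abel {β : ℝ} (hβ1 : β < 1) {r : ℝ → ℝ} (hr : Continuous r) (t : ℝ) :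
    IntervalIntegrable (fun x => (t - x) ^ (-β) * r x) volume 0 t := by
  have h1 := (intervalIntegral.intervalIntegrable_rpow' (a := t) (b := 0) (r := -β)
    (by linarith)).comp_sub_left t
  rw [sub_self, sub_zero] at h1
  exact h1.mul_continuousOn hr.continuousOn

/-- Because `r` vanishes on the negative axis, the moving endpoint can be removed and the
singularity placed at `0`, ready for dominated convergence in `t`. -/
lemma abel_integral_eq {β : ℝ} {r : ℝ → ℝ} (hr0 : ∀ x ≤ 0, r x = 0) {t : ℝ} (ht : 0 ≤ t) :
    ∫ x in (0 : ℝ)..t, (t - x) ^ (-β) * r x = ∫ y in Ioi (0 : ℝ), y ^ (-β) * r (t - y) := by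
  have h := intervalIntegral.integral_comp_sub_left (a := 0) (b := t)
    (fun y => y ^ (-β) * r (t - y)) t
  simp only [sub_sub_cancel, sub_self, sub_zero] at h
  rw [h, intervalIntegral.integral_of_le ht]
  refine (setIntegral_eq_of_subset_of_forall_sdiff_eq_zero measurableSet_Ioi Ioc_subset_Ioi_self ?_).symm
  rintro y ⟨hy, hy'⟩
  have : t < y := by
    by_contra hh
    exact hy' ⟨hy, not_lt.1 hh⟩
  rw [hr0 _ (by linarith), mul_zero]

lemma continuousAt_abel_integral {β : ℝ} (hβ1 : β < 1) {r : ℝ → ℝ} (hr : Continuous r)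
    (hr0 : ∀ x ≤ 0, r x = 0) {C : ℝ} (hC : ∀ x, |r x| ≤ C) {t : ℝ} (ht : 0 < t) :
    ContinuousAt (fun t => ∫ x in (0 : ℝ)..t, (t - x) ^ (-β) * r x) t := by
  have h : ContinuousAt (fun t => ∫ y in Ioi (0 : ℝ), y ^ (-β) * r (t - y)) t := by
    refine continuousAt_of_dominated
      (bound := (Ioc (0 : ℝ) (t + 1)).indicator fun y => y ^ (-β) * C) ?_ ?_ ?_ ?_
    · exact .of_forall fun u => (Measurable.mul (by fun_prop)
        (hr.measurable.comp (by fun_prop))).aestronglyMeasurable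
    · filter_upwards [Iio_mem_nhds (lt_add_one t)] with u hu
      refine (ae_restrict_iff' measurableSet_Ioi).2 (.of_forall fun y hy => ?_)
      have hy' : 0 < y := hy
      by_cases h : y ≤ t + 1
      · rw [indicator_of_mem (show y ∈ Ioc 0 (t + 1) from ⟨hy', h⟩), norm_mul, Real.norm_eq_abs, Real.norm_eq_abs,
          abs_of_pos (Real.rpow_pos_of_pos hy' _)]
        exact mul_le_mul_of_nonneg_left (hC _) (by positivity)
      · have hu' : u < t + 1 := hu
        rw [indicator_of_notMem (fun hh => h hh.2), hr0 _ (by linarith), mul_zero, norm_zero]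
    · refine Integrable.mono_measure ((integrable_indicator_iff measurableSet_Ioc).2 ?_)
        Measure.restrict_le_self
      have h1 := intervalIntegral.intervalIntegrable_rpow' (a := 0) (b := t + 1) (r := -β)
        (by linarith)
      exact ((intervalIntegrable_iff_integrableOn_Ioc_of_le (by linarith)).1 h1).mul_const C
    · exact .of_forall fun y => by fun_prop
  refine h.congr ?_
  filter_upwards [Ioi_mem_nhds ht] with u hu
  exact (abel_integral_eq hr0 (le_of_lt hu)).symm

/-- The Laplace transform of an Abel integral. -/
lemma laplace_abel_integral {β : ℝ} (hβ1 : β < 1) {r : ℝ → ℝ} {s : ℝ} (hs : 0 < s)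
    (hr : IntegrableOn (fun x => Real.exp (-(s * x)) * r x) (Ioi 0)) :
    IntegrableOn (fun t => Real.exp (-(s * t)) * ∫ x in (0 : ℝ)..t, (t - x) ^ (-β) * r x) (Ioi 0) ∧
    ∫ t in Ioi (0 : ℝ), Real.exp (-(s * t)) * ∫ x in (0 : ℝ)..t, (t - x) ^ (-β) * r x =
      (∫ x in Ioi (0 : ℝ), Real.exp (-(s * x)) * r x) * (s ^ (β - 1) * Real.Gamma (1 - β)) := by
  have hg : IntegrableOn (fun y : ℝ => y ^ (-β) * Real.exp (-(s * y))) (Ioi 0) := by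
    simpa using integrableOn_rpow_mul_exp_neg_mul_rpow (s := -β) (p := 1) (b := s)
      (by linarith) one_pos hs
  have hgi : ∫ y in Ioi (0 : ℝ), y ^ (-β) * Real.exp (-(s * y)) =
      s ^ (β - 1) * Real.Gamma (1 - β) := by
    have h := Real.integral_rpow_mul_exp_neg_mul_Ioi (a := 1 - β) (r := s) (by linarith) hs
    rw [sub_sub_cancel_left] at h
    rw [h, one_div, Real.inv_rpow hs.le, ← Real.rpow_neg hs.le, neg_sub]
  have he : ∀ t : ℝ, ∫ x in (0 : ℝ)..t, (ContinuousLinearMap.mul ℝ ℝ (Real.exp (-(s * x)) * r x))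
      ((t - x) ^ (-β) * Real.exp (-(s * (t - x)))) =
      Real.exp (-(s * t)) * ∫ x in (0 : ℝ)..t, (t - x) ^ (-β) * r x := fun t => by
    rw [← intervalIntegral.integral_const_mul]
    congr 1 with x
    have : Real.exp (-(s * t)) = Real.exp (-(s * x)) * Real.exp (-(s * (t - x))) := by
      rw [← Real.exp_add]; ring_nf
    rw [this, ContinuousLinearMap.mul_apply']
    ring
  have h1 := integrable_posConvolution hr hg (ContinuousLinearMap.mul ℝ ℝ)
  have h2 := integral_posConvolution hr hg (ContinuousLinearMap.mul ℝ ℝ)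
  simp only [posConvolution, he] at h1
  simp_rw [he] at h2
  rw [ContinuousLinearMap.mul_apply', hgi] at h2
  exact ⟨(integrable_indicator_iff measurableSet_Ioi).1 h1, h2⟩

lemma abs_stableDensity_le {β : ℝ} (hβ0 : 0 < β) (hβ1 : β < 1) :
    ∃ C, ∀ x, |stableDensity β (-β) x| ≤ C := by
  refine ⟨‖(1 / (2 * Real.pi) : ℂ)‖ * ∫ κ : ℝ, ‖stableCharFun β κ‖, fun x => ?_⟩
  rw [← Real.norm_eq_abs, ← Complex.norm_real, ofReal_stableDensity hβ0 hβ1, norm_mul]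
  refine mul_le_mul_of_nonneg_left ?_ (norm_nonneg _)
  refine norm_integral_le_of_norm_le (integrable_stableCharFun hβ0 hβ1).norm (.of_forall fun κ => ?_)
  rw [norm_mul, Complex.norm_exp]
  simp

/-- `q_β` is the Riemann-Liouville integral of order `1 - β` of `r_β`. -/
lemma qDensity_eq_riemannLiouville {β t τ : ℝ} (hβ0 : 0 < β) (hβ1 : β < 1) (ht : 0 < t)
    (hτ : 0 < τ) :
    qDensity β τ t = riemannLiouville (1 - β) (fun x => rDensity β x τ) t := by
  have hG : Real.Gamma (1 - β) ≠ 0 := (Real.Gamma_pos_of_pos (by linarith)).ne'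
  set R : ℝ → ℝ := fun t => ∫ x in (0 : ℝ)..t, (t - x) ^ (-β) * rDensity β x τ with hR
  have hr := continuous_rDensity hβ0 hβ1 hτ
  have hlap : ∀ s : ℝ, 0 < s →
      IntegrableOn (fun x => Real.exp (-(s * x)) * (qDensity β τ x - R x / Real.Gamma (1 - β))) (Ioi 0) ∧
      ∫ x in Ioi (0 : ℝ), Real.exp (-(s * x)) * (qDensity β τ x - R x / Real.Gamma (1 - β)) = 0 := by
    intro s hs
    have hrl := HasLaplaceAt.ofReal (s := s) (F := Real.exp (-(τ * s ^ β))) (by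
      have := hasLaplaceAt_rDensity hβ0 hβ1 hτ (s := (s : ℂ)) (by simpa using hs.le)
      push_cast
      rwa [Complex.ofReal_cpow hs.le])
    have hql := HasLaplaceAt.ofReal (s := s) (F := s ^ (β - 1) * Real.exp (-(τ * s ^ β))) (by
      have := hasLaplaceAt_qDensity hβ0 hβ1 hτ (s := (s : ℂ)) (by simpa using hs)
      push_cast
      rw [Complex.ofReal_cpow hs.le, Complex.ofReal_cpow hs.le]
      push_cast
      exact this)
    obtain ⟨hi, hv⟩ := laplace_abel_integral hβ1 hs hrl.1
    have he : ∀ x, Real.exp (-(s * x)) * (qDensity β τ x - R x / Real.Gamma (1 - β)) =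
        Real.exp (-(s * x)) * qDensity β τ x - Real.exp (-(s * x)) * R x / Real.Gamma (1 - β) :=
      fun x => by ring
    simp_rw [he]
    refine ⟨hql.1.sub (Integrable.div_const hi _), ?_⟩
    rw [integral_sub hql.1 (Integrable.div_const hi _), integral_div, hv, hql.2, hrl.2]
    field_simp
    ring
  obtain ⟨C, hC⟩ := abs_stableDensity_le hβ0 hβ1
  have hRc : ContinuousAt R t := continuousAt_abel_integral hβ1 hr
    (fun x hx => rDensity_of_nonpos hβ0 hβ1 hτ hx) (C := (τ ^ (1 / β))⁻¹ * C) (fun x => by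
      have hpos : 0 < (τ ^ (1 / β))⁻¹ := by positivity
      rw [rDensity_eq hτ, abs_mul, abs_of_pos hpos]
      exact mul_le_mul_of_nonneg_left (hC _) hpos.le) ht
  have hqc : ContinuousAt (fun t => qDensity β τ t) t := by
    have h1 : ContinuousAt (fun t => t / (β * τ) * rDensity β t τ) t :=
      ContinuousAt.mul (by fun_prop) hr.continuousAt
    refine h1.congr ?_
    filter_upwards [Ioi_mem_nhds ht] with x hx
    exact (qDensity_eq_rDensity hβ0 hβ1 hx hτ).symm
  -- The factor `exp (-x)` provides integrability on the half-line and shifts the Laplace variable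
  -- to `s + 1`.
  have hz := eq_zero_of_laplace_eq_zero (f := fun x =>
    ((Real.exp (-(1 * x)) * (qDensity β τ x - R x / Real.Gamma (1 - β)) : ℝ) : ℂ))
    (hlap 1 one_pos).1.ofReal (fun s hs => ?_) ht ?_
  · have h0 : qDensity β τ t - R t / Real.Gamma (1 - β) = 0 := by
      have : Real.exp (-(1 * t)) * (qDensity β τ t - R t / Real.Gamma (1 - β)) = 0 := by
        exact_mod_cast hz
      exact (mul_eq_zero.1 this).resolve_left (Real.exp_pos _).ne'
    rw [sub_eq_zero.1 h0, riemannLiouville, sub_sub_cancel_left, hR]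
    ring
  · have h1 := (hlap (s + 1) (by linarith)).2
    have h2 : ∀ x : ℝ, Complex.exp (-((s : ℂ) * x)) *
        ((Real.exp (-(1 * x)) * (qDensity β τ x - R x / Real.Gamma (1 - β)) : ℝ) : ℂ) =
        ((Real.exp (-((s + 1) * x)) * (qDensity β τ x - R x / Real.Gamma (1 - β)) : ℝ) : ℂ) := fun x => by
      rw [show -((s + 1) * x) = -(s * x) + -(1 * x) by ring, Real.exp_add]
      push_cast
      ring
    simp_rw [h2]
    rw [integral_complex_ofReal, h1, Complex.ofReal_zero]
  · have : ContinuousAt (fun x => Real.exp (-(1 * x)) * (qDensity β τ x - R x / Real.Gamma (1 - β))) t :=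
      ContinuousAt.mul (by fun_prop) (hqc.sub (hRc.div_const _))
    exact Complex.continuous_ofReal.continuousAt.comp this

lemma integral_stableDensity {β : ℝ} (hβ0 : 0 < β) (hβ1 : β < 1) :
    ∫ x, stableDensity β (-β) x = 1 := by
  have hi := integrable_stableDensity hβ0 hβ1
  have h := real_laplace_stableDensity hβ0 hβ1 le_rfl
  simp only [zero_mul, neg_zero, Real.exp_zero, one_mul, Real.zero_rpow hβ0.ne'] at h
  rw [← intervalIntegral.integral_Iic_add_Ioi (b := 0) hi.integrableOn hi.integrableOn, h,
    setIntegral_congr_fun (g := fun _ => (0 : ℝ)) measurableSet_Iic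
      (fun y hy => stableDensity_of_nonpos hβ0 hβ1 hy), integral_zero, zero_add]

/-! ### Inverse of a right-continuous path -/

section Path

variable {f : ℝ≥0 → ℝ}

/-- The Galois connection between a right-continuous monotone path and its inverse. -/
lemma sInf_le_iff_of_rightCont (hm : Monotone f)
    (hc : ∀ τ, ContinuousWithinAt f (Ici τ) τ) {t : ℝ} (hne : ∃ τ, t ≤ f τ) (τ : ℝ≥0) :
    sInf {τ : ℝ≥0 | t ≤ f τ} ≤ τ ↔ t ≤ f τ := by
  refine ⟨fun h => ?_, fun h => csInf_le (OrderBot.bddBelow _) h⟩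
  refine le_trans ?_ (hm h)
  -- If the path were below `t` at the infimum, right-continuity would keep it below `t` on an
  -- interval to the right, which must contain a point of the set.
  by_contra! hlt
  have hev := (hc (sInf {τ : ℝ≥0 | t ≤ f τ})).eventually_lt_const hlt
  obtain ⟨u, hu, hsub⟩ := (mem_nhdsGE_iff_exists_Ico_subset).1 hev
  obtain ⟨v, hv, hvu⟩ := exists_lt_of_csInf_lt (s := {τ : ℝ≥0 | t ≤ f τ}) hne hu
  have h1 : f v < t := hsub ⟨csInf_le (OrderBot.bddBelow _) hv, hvu⟩
  have h2 : t ≤ f v := hv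
  exact h1.not_ge h2

end Path

/-! ### The subordinator and the law of its inverse -/

namespace IsStableSubordinator

variable {Ω : Type*} [MeasurableSpace Ω] {P : Measure Ω} [IsProbabilityMeasure P]
  {β : ℝ} (hβ0 : 0 < β) (hβ1 : β < 1) {T : ℝ≥0 → Ω → ℝ} (hT : IsStableSubordinator β T P)

include hβ0 hβ1 hT

/-- `ENNReal.ofReal` truncates at zero, so the law of `T 1` says only that the positive part of `L`
has mass `1`. As `∫ L = 1`, the negative part has mass zero, and continuity makes it vanish
everywhere. -/
lemma stableDensity_nonneg (x : ℝ) : 0 ≤ stableDensity β (-β) x := by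
  have hc := continuous_stableDensity hβ0 hβ1
  have h1 : ∫⁻ x, ENNReal.ofReal (stableDensity β (-β) x) = 1 := by
    have hd := hT.density 1 one_pos
    have hp : IsProbabilityMeasure (P.map (T 1)) :=
      Measure.isProbabilityMeasure_map (hT.measurable 1).aemeasurable
    have hu := hp.measure_univ
    rw [hd, withDensity_apply _ MeasurableSet.univ, setLIntegral_univ] at hu
    simpa [rDensity] using hu
  have h2 := integral_eq_lintegral_pos_part_sub_lintegral_neg_part (integrable_stableDensity hβ0 hβ1)
  rw [integral_stableDensity hβ0 hβ1, h1, ENNReal.toReal_one, eq_comm, sub_eq_self,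
    ENNReal.toReal_eq_zero_iff] at h2
  have h3 : ∫⁻ x, ENNReal.ofReal (-stableDensity β (-β) x) ≠ ∞ :=
    ((integrable_stableDensity hβ0 hβ1).neg.lintegral_lt_top).ne
  have h4 := h2.resolve_right h3
  have hc' : Continuous fun x => ENNReal.ofReal (-stableDensity β (-β) x) :=
    ENNReal.continuous_ofReal.comp hc.neg
  rw [lintegral_eq_zero_iff hc'.measurable] at h4
  have h5 := (Continuous.ae_eq_iff_eq volume hc' continuous_const).1 h4
  have h6 := congrFun h5 x
  simpa using h6

lemma measure_le (t : ℝ) (ht : 0 < t) (τ : ℝ≥0) :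
    P {ω | t ≤ T τ ω} = ENNReal.ofReal (∫ τ' in (0 : ℝ)..τ, qDensity β τ' t) := by
  have hL := stableDensity_nonneg hβ0 hβ1 hT
  rcases eq_or_lt_of_le (zero_le (a := τ)) with h0 | hτ
  · rw [← h0, NNReal.coe_zero, intervalIntegral.integral_same, ENNReal.ofReal_zero]
    refine measure_mono_null (t := {ω | ¬T 0 ω = 0}) (fun ω hω => ?_) (ae_iff.1 hT.zero)
    have h1 : t ≤ T 0 ω := hω
    exact (ht.trans_le h1).ne'
  · have hτ' : (0 : ℝ) < τ := by exact_mod_cast hτ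
    have h := Measure.map_apply (μ := P) (hT.measurable τ) (measurableSet_Ici (a := t))
    rw [hT.density τ hτ, withDensity_apply _ measurableSet_Ici] at h
    change P (T τ ⁻¹' Ici t) = _
    rw [← h, integral_qDensity_eq_tail hβ0 hβ1 ht hτ', ← integral_Ici_eq_integral_Ioi,
      ofReal_integral_eq_lintegral_ofReal (integrable_rDensity hβ0 hβ1 hτ').integrableOn
      (.of_forall fun x => rDensity_nonneg hL hτ')]

/-- The probability that `T m` reaches a given level is `∫ q` over `(0, m]`, which tends to `1`.
This excludes the default value `sInf ∅ = 0`. -/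
lemma ae_unbounded : ∀ᵐ ω ∂P, ∀ t : ℝ, ∃ τ : ℝ≥0, t ≤ T τ ω := by
  have hL := stableDensity_nonneg hβ0 hβ1 hT
  have h : ∀ n : ℕ, ∀ᵐ ω ∂P, ∃ m : ℕ, ((n : ℝ) + 1) ≤ T (m : ℝ≥0) ω := fun n => by
    have hn : (0 : ℝ) < n + 1 := by positivity
    have hmeas : MeasurableSet (⋃ m : ℕ, {ω | (n : ℝ) + 1 ≤ T (m : ℝ≥0) ω}) :=
      MeasurableSet.iUnion fun m => measurableSet_le measurable_const (hT.measurable _)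
    have hlim : Filter.Tendsto (fun m : ℕ => P {ω | (n : ℝ) + 1 ≤ T (m : ℝ≥0) ω}) Filter.atTop
        (nhds 1) := by
      simp_rw [measure_le hβ0 hβ1 hT _ hn]
      have h1 := intervalIntegral_tendsto_integral_Ioi 0 (integrableOn_qDensity hβ0 hβ1 hL hn)
        (tendsto_natCast_atTop_atTop (R := ℝ))
      rw [integral_qDensity hβ0 hβ1 hL hn] at h1
      have h2 := (ENNReal.continuous_ofReal.tendsto 1).comp h1
      rw [ENNReal.ofReal_one] at h2
      exact h2
    have h1 : P (⋃ m : ℕ, {ω | (n : ℝ) + 1 ≤ T (m : ℝ≥0) ω}) = 1 :=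
      le_antisymm prob_le_one (le_of_tendsto' hlim fun m =>
        measure_mono (subset_iUnion (fun m : ℕ => {ω | (n : ℝ) + 1 ≤ T (m : ℝ≥0) ω}) m))
    have h2 := (prob_compl_eq_zero_iff hmeas).2 h1
    filter_upwards [compl_mem_ae_iff.2 h2] with ω hω
    simpa using hω
  filter_upwards [ae_all_iff.2 h] with ω hω t
  obtain ⟨n, hn⟩ := exists_nat_ge t
  obtain ⟨m, hm⟩ := hω n
  exact ⟨m, by linarith⟩

lemma ae_inverseProcess :
    ∀ᵐ ω ∂P, (∀ t : ℝ, ∀ τ : ℝ≥0, inverseProcess T t ω ≤ τ ↔ t ≤ T τ ω) ∧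
      Monotone (fun t : ℝ => inverseProcess T t ω) := by
  filter_upwards [ae_unbounded hβ0 hβ1 hT, hT.mono, hT.rightCont] with ω h1 h2 h3
  refine ⟨fun t τ => sInf_le_iff_of_rightCont h2 h3 (h1 t) τ, fun t t' htt => ?_⟩
  exact csInf_le_csInf (OrderBot.bddBelow _) (h1 t') fun τ hτ => htt.trans hτ

lemma aemeasurable_inverseProcess (t : ℝ) : AEMeasurable (inverseProcess T t) P := by
  have h := ae_inverseProcess hβ0 hβ1 hT
  obtain ⟨N, hN, hNm, hN0⟩ := exists_measurable_superset_of_null (ae_iff.1 h)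
  -- Off a null set the sublevel sets are `{t ≤ T τ}`; the modification is `0` on that null set, so
  -- each sublevel set contains all of it.
  refine ⟨Nᶜ.indicator (inverseProcess T t), ?_, ?_⟩
  · refine measurable_of_Iic fun τ => ?_
    have : Nᶜ.indicator (inverseProcess T t) ⁻¹' Iic τ = N ∪ {ω | t ≤ T τ ω} := by
      ext ω
      by_cases hω : ω ∈ N
      · simp [hω]
      · have hgood := not_not.1 (fun hh => hω (hN hh))
        rw [mem_preimage, indicator_of_mem hω, mem_Iic, hgood.1 t τ]
        simp [hω]
    rw [this]
    exact hNm.union (measurableSet_le measurable_const (hT.measurable τ))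
  · filter_upwards [compl_mem_ae_iff.2 hN0] with ω hω
    rw [indicator_of_mem hω]

/-- Comparison of distribution functions: the Galois connection turns `{inverse ≤ a}` into `{t ≤ T
a}`, whose probability is the integral of `q` up to `a`. -/
lemma map_inverseProcess (t : ℝ) (ht : 0 < t) :
    P.map (fun ω => (inverseProcess T t ω : ℝ)) =
      (volume.restrict (Ioi (0 : ℝ))).withDensity (fun τ => ENNReal.ofReal (qDensity β τ t)) := by
  have hL := stableDensity_nonneg hβ0 hβ1 hT
  have hm : AEMeasurable (fun ω => (inverseProcess T t ω : ℝ)) P :=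
    (aemeasurable_inverseProcess hβ0 hβ1 hT t).coe_nnreal_real
  refine Measure.ext_of_Iic _ _ fun a => ?_
  rw [Measure.map_apply_of_aemeasurable hm measurableSet_Iic, withDensity_apply _ measurableSet_Iic,
    Measure.restrict_restrict measurableSet_Iic, inter_comm, Ioi_inter_Iic]
  rcases lt_or_ge a 0 with ha | ha
  · rw [Ioc_eq_empty (by linarith), Measure.restrict_empty, lintegral_zero_measure]
    have : (fun ω => (inverseProcess T t ω : ℝ)) ⁻¹' Iic a = ∅ := by
      ext ω
      simp only [mem_preimage, mem_Iic, mem_empty_iff_false, iff_false, not_le]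
      exact ha.trans_le (NNReal.coe_nonneg _)
    rw [this, measure_empty]
  · lift a to ℝ≥0 using ha
    have h1 : P ((fun ω => (inverseProcess T t ω : ℝ)) ⁻¹' Iic (a : ℝ)) = P {ω | t ≤ T a ω} := by
      refine measure_congr ?_
      filter_upwards [ae_inverseProcess hβ0 hβ1 hT] with ω hω
      refine propext ?_
      change ((inverseProcess T t ω : ℝ) ≤ a) ↔ t ≤ T a ω
      rw [NNReal.coe_le_coe, hω.1 t a]
    rw [h1, measure_le hβ0 hβ1 hT t ht, intervalIntegral.integral_of_le (NNReal.coe_nonneg a),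
      ofReal_integral_eq_lintegral_ofReal
        ((integrableOn_qDensity hβ0 hβ1 hL ht).mono_set Ioc_subset_Ioi_self)]
    exact (ae_restrict_iff' measurableSet_Ioc).2 (.of_forall fun τ hτ =>
      qDensity_nonneg hβ0 hβ1 hL ht hτ.1)

end IsStableSubordinator

theorem mainTheorem2 {Ω : Type*} [MeasurableSpace Ω] (P : Measure Ω) [IsProbabilityMeasure P]
    (β : ℝ) (hβ0 : 0 < β) (hβ1 : β < 1) (T : ℝ≥0 → Ω → ℝ)
    (hT : IsStableSubordinator β T P) :
    -- the process `inverseProcess T` is the inverse of `T` and is weakly increasing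
    (∀ᵐ ω ∂P, (∀ t : ℝ, 0 ≤ t → ∀ τ : ℝ≥0, inverseProcess T t ω ≤ τ ↔ t ≤ T τ ω) ∧
      MonotoneOn (fun t : ℝ => inverseProcess T t ω) (Ici 0)) ∧
    -- at every time `t > 0` it has the density `q_β(·, t)`, a probability density on `(0, ∞)`
    (∀ t : ℝ, 0 < t →
      AEMeasurable (inverseProcess T t) P ∧
      P.map (fun ω => (inverseProcess T t ω : ℝ)) =
        (volume.restrict (Ioi (0 : ℝ))).withDensity
          (fun τ => ENNReal.ofReal (qDensity β τ t)) ∧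
      (∀ τ : ℝ, 0 < τ → 0 ≤ qDensity β τ t) ∧
      IntegrableOn (fun τ => qDensity β τ t) (Ioi 0) ∧
      ∫ τ in Ioi (0 : ℝ), qDensity β τ t = 1) ∧
    -- distribution function of the inverse process against the tail of the subordinator
    (∀ t τ : ℝ, 0 < t → 0 < τ →
      IntegrableOn (fun t' => rDensity β t' τ) (Ioi t) ∧
      ∫ τ' in (0 : ℝ)..τ, qDensity β τ' t = ∫ t' in Ioi t, rDensity β t' τ) ∧
    -- `q_β` as a fractional integral of `r_β`
    (∀ t τ : ℝ, 0 < t → 0 < τ →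
      IntervalIntegrable (fun x => (t - x) ^ (-β) * rDensity β x τ) volume 0 t ∧
      qDensity β τ t = riemannLiouville (1 - β) (fun x => rDensity β x τ) t) ∧
    -- Laplace transforms in `t`
    (∀ (τ : ℝ) (s : ℂ), 0 < τ → 0 < s.re →
      HasLaplaceAt (fun t => (rDensity β t τ : ℂ)) s (Complex.exp (-(τ * s ^ (β : ℂ)))) ∧
      HasLaplaceAt (fun t => (qDensity β τ t : ℂ)) s
        (s ^ ((β : ℂ) - 1) * Complex.exp (-(τ * s ^ (β : ℂ))))) ∧
    -- Laplace transforms in `τ`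
    (∀ (t : ℝ) (p : ℂ), 0 < t → 0 ≤ p.re →
      HasLaplaceAt (fun τ => (rDensity β t τ : ℂ)) p
        (((β * t ^ (β - 1) : ℝ) : ℂ) *
          deriv (mittagLeffler β) (-(p * ((t ^ β : ℝ) : ℂ)))) ∧
      HasLaplaceAt (fun τ => (qDensity β τ t : ℂ)) p
        (mittagLeffler β (-(p * ((t ^ β : ℝ) : ℂ))))) ∧
    (∀ (t : ℝ) (p : ℂ), 0 < t → 0 < p.re →
      IntegrableOn (fun x : ℝ => p * ((β * x ^ (β - 1) : ℝ) : ℂ) *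
        deriv (mittagLeffler β) (-(p * ((x ^ β : ℝ) : ℂ)))) (Ioi t) ∧
      ∫ x in Ioi t, p * ((β * x ^ (β - 1) : ℝ) : ℂ) *
          deriv (mittagLeffler β) (-(p * ((x ^ β : ℝ) : ℂ))) =
        mittagLeffler β (-(p * ((t ^ β : ℝ) : ℂ)))) ∧
    -- double Laplace transforms
    (∀ p s : ℂ, 0 ≤ p.re → 0 < s.re →
      HasDoubleLaplaceAt (fun τ t => (rDensity β t τ : ℂ)) p s (1 / (p + s ^ (β : ℂ))) ∧
      HasDoubleLaplaceAt (fun τ t => (qDensity β τ t : ℂ)) p s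
        (s ^ ((β : ℂ) - 1) / (p + s ^ (β : ℂ)))) := by
  have hL := hT.stableDensity_nonneg hβ0 hβ1
  refine ⟨?_, fun t ht => ⟨hT.aemeasurable_inverseProcess hβ0 hβ1 t,
      hT.map_inverseProcess hβ0 hβ1 t ht, fun τ hτ => qDensity_nonneg hβ0 hβ1 hL ht hτ,
      integrableOn_qDensity hβ0 hβ1 hL ht, integral_qDensity hβ0 hβ1 hL ht⟩,
    fun t τ ht hτ => ⟨(integrable_rDensity hβ0 hβ1 hτ).integrableOn,
      integral_qDensity_eq_tail hβ0 hβ1 ht hτ⟩,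
    fun t τ ht hτ => ⟨intervalIntegrable_abel hβ1 (continuous_rDensity hβ0 hβ1 hτ) t,
      qDensity_eq_riemannLiouville hβ0 hβ1 ht hτ⟩,
    fun τ s hτ hs => ⟨hasLaplaceAt_rDensity hβ0 hβ1 hτ hs.le, hasLaplaceAt_qDensity hβ0 hβ1 hτ hs⟩,
    fun t p ht _ => ⟨hasLaplaceAt_rDensity_operational hβ0 hβ1 hL ht p,
      hasLaplaceAt_qDensity_operational hβ0 hβ1 hL ht p⟩,
    fun t p ht hp => integral_deriv_mittagLeffler hβ0 hβ1 hL ht hp,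
    fun p s hp hs => ⟨hasDoubleLaplaceAt_rDensity hβ0 hβ1 hL hp hs,
      hasDoubleLaplaceAt_qDensity hβ0 hβ1 hL hp hs⟩⟩
  filter_upwards [hT.ae_inverseProcess hβ0 hβ1] with ω hω
  exact ⟨fun t _ τ => hω.1 t τ, hω.2.monotoneOn _⟩
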